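/- Let $y\in\mathbb R^n$, let $X_\ell$ be an $n\times d_\ell$ real matrix of full column rank $d_\ell<n$, and let $X_0$ be an $n\times d_0$ matrix formed by $d_0$ distinct columns of $X_\ell$. For $j\in\{0,\ell\}$ let $M_j$ be the Gaussian linear model with likelihood $f_j(y\mid\beta_j,\sigma_j^2)=f_{N_n}(y;X_j\beta_j,\sigma_j^2 I_n)$, $\beta_j\in\mathbb R^{d_j}$, $\sigma_j^2>0$, where $f_{N_n}(\cdot\,;\mu,\Sigma)$ is the density of $N_n(\mu,\Sigma)$, and with the improper baseline (independence Jeffreys) prior $\pi_j^N(\beta_j,\sigma_j^2)=c_j/\sigma_j^2$, $c_j>0$ arbitrary. Put $RSS_j=y^T\bigl(I_n-X_j(X_j^TX_j)^{-1}X_j^T\bigr)y$. The J-PEP prior with power parameter $\delta=n$, imaginary sample size $n^*=n$ and imaginary design matrices $X_j^*=X_j$ is defined as follows. Let $$f_j(y^*\mid\beta_j,\sigma_j^2;\delta)=\frac{f_j(y^*\mid\beta_j,\sigma_j^2)^{1/\delta}}{\int_{\mathbb R^n} f_j(z\mid\beta_j,\sigma_j^2)^{1/\delta}\,dz},\qquad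 m_j^N(y^*\mid\delta)=\iint f_j(y^*\mid\beta_j,\sigma_j^2;\delta)\,\pi_j^N(\beta_j,\sigma_j^2)\,d\beta_j\,d\sigma_j^2,$$ $$\pi_\ell^{J\text{-}PEP}(\beta_\ell,\sigma_\ell^2)=\pi_\ell^N(\beta_\ell,\sigma_\ell^2)\int_{\mathbb R^n}\frac{m_0^N(y^*\mid\delta)}{m_\ell^N(y^*\mid\delta)}\,f_\ell(y^*\mid\beta_\ell,\sigma_\ell^2;\delta)\,dy^* ,$$ the prior of the reference model $M_0$ being its baseline prior. The J-PEP Bayes factor of $M_\ell$ versus $M_0$ is $$BF_{\ell 0}^{J\text{-}PEP}=\frac{\iint f_\ell(y\mid\beta_\ell,\sigma_\ell^2)\,\pi_\ell^{J\text{-}PEP}(\beta_\ell,\sigma_\ell^2)\,d\beta_\ell\,d\sigma_\ell^2}{\iint f_0(y\mid\beta_0,\sigma_0^2)\,\pi_0^{N}(\beta_0,\sigma_0^2)\,d\beta_0\,d\sigma_0^2}.$$ If $RSS_0>0$, then the denominator is positive and finite, and $$BF_{\ell 0}^{J\text{-}PEP}=\frac{2\,\Gamma(n-d_\ell)}{\Gamma\!\left(\frac{n-d_\ell}{2}\right)^2}\int_0^{\pi/2}\frac{(\sin\phi)^{n-d_0-1}(\cos\phi)^{n-d_\ell-1}(n+\sin^2\phi)^{\frac{n-d_\ell}{2}}}{\left(n\,\frac{RSS_\ell}{RSS_0}+\sin^2\phi\right)^{\frac{n-d_0}{2}}}\,d\phi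 ,$$ as an identity in $[0,\infty]$; if moreover $RSS_\ell>0$, the integral converges and both sides are finite. -/

import Mathlib

open scoped Matrix ENNReal

noncomputable section

namespace JPEP

/-- Density at `y` of the `k`-dimensional Normal distribution with mean `μ` and covariance
matrix `S`, with respect to Lebesgue measure on `ℝᵏ`. -/
def normalDensity {k : ℕ} (μ : Fin k → ℝ) (S : Matrix (Fin k) (Fin k) ℝ) (y : Fin k → ℝ) : ℝ :=
  (2 * Real.pi) ^ (-(k : ℝ) / 2) * S.det ^ (-(1 : ℝ) / 2) *
    Real.exp (-(1 / 2) * ((y - μ) ⬝ᵥ (S⁻¹ *ᵥ (y - μ))))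

/-- Likelihood of the Gaussian linear model with design matrix `X`, coefficients `β` and error
variance `v`: the density `f_{N_k}(y ; X β, v I)`. -/
def likelihood {k d : ℕ} (X : Matrix (Fin k) (Fin d) ℝ) (β : Fin d → ℝ) (v : ℝ)
    (y : Fin k → ℝ) : ℝ≥0∞ :=
  ENNReal.ofReal (normalDensity (X *ᵥ β) (v • (1 : Matrix (Fin k) (Fin k) ℝ)) y)

/-- The likelihood raised to the power `1 / δ` and density-normalized. -/
def powerLikelihood {k d : ℕ} (X : Matrix (Fin k) (Fin d) ℝ) (δ : ℝ) (β : Fin d → ℝ) (v : ℝ)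
    (y : Fin k → ℝ) : ℝ≥0∞ :=
  likelihood X β v y ^ (1 / δ) / ∫⁻ z : Fin k → ℝ, likelihood X β v z ^ (1 / δ)

/-- The independence Jeffreys baseline prior `c / v` of the parameters `(β, v)`, `v > 0`
(improper; `c` is its arbitrary normalizing constant). -/
def baselinePrior {d : ℕ} (c : ℝ) (_β : Fin d → ℝ) (v : ℝ) : ℝ≥0∞ :=
  ENNReal.ofReal (c / v)

/-- Prior predictive density at `y` (marginal likelihood) of the power likelihood under the
baseline prior. -/
def baselinePredictive {k d : ℕ} (c : ℝ) (X : Matrix (Fin k) (Fin d) ℝ) (δ : ℝ)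
    (y : Fin k → ℝ) : ℝ≥0∞ :=
  ∫⁻ v in Set.Ioi (0 : ℝ), ∫⁻ β : Fin d → ℝ, powerLikelihood X δ β v y * baselinePrior c β v

/-- The J-PEP prior of the parameters `(β, v)` of the model with imaginary design matrix `Xs`,
relative to the reference model with imaginary design matrix `X0s`; `k` is the size of the
imaginary sample, and `c`, `c0` are the constants of the two baseline priors. -/
def jpepPrior {k d d0 : ℕ} (c c0 : ℝ) (Xs : Matrix (Fin k) (Fin d) ℝ)
    (X0s : Matrix (Fin k) (Fin d0) ℝ) (δ : ℝ) (β : Fin d → ℝ) (v : ℝ) : ℝ≥0∞ :=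
  baselinePrior c β v *
    ∫⁻ ys : Fin k → ℝ, baselinePredictive c0 X0s δ ys / baselinePredictive c Xs δ ys *
      powerLikelihood Xs δ β v ys

/-- Marginal likelihood of the data `y` under the model with design matrix `X` and prior density
`prior` of its parameters `(β, v)`, `v > 0`. -/
def marginalLikelihood {n d : ℕ} (X : Matrix (Fin n) (Fin d) ℝ)
    (prior : (Fin d → ℝ) → ℝ → ℝ≥0∞) (y : Fin n → ℝ) : ℝ≥0∞ :=
  ∫⁻ v in Set.Ioi (0 : ℝ), ∫⁻ β : Fin d → ℝ, likelihood X β v y * prior β v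

/-- The J-PEP Bayes factor of the model with design matrix `X` versus the reference model with
design matrix `X0`, for imaginary design matrices `Xs`, `X0s` (with `k` rows) and power parameter
`δ`. The prior of the reference model is its baseline prior. -/
def jpepBayesFactor {n k d d0 : ℕ} (c c0 : ℝ) (X : Matrix (Fin n) (Fin d) ℝ)
    (X0 : Matrix (Fin n) (Fin d0) ℝ) (Xs : Matrix (Fin k) (Fin d) ℝ)
    (X0s : Matrix (Fin k) (Fin d0) ℝ) (δ : ℝ) (y : Fin n → ℝ) : ℝ≥0∞ :=
  marginalLikelihood X (jpepPrior c c0 Xs X0s δ) y /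
    marginalLikelihood X0 (baselinePrior c0) y

/-- The residual sum of squares `yᵀ P y` with `P = I - X (Xᵀ X)⁻¹ Xᵀ`. -/
def rss {n d : ℕ} (X : Matrix (Fin n) (Fin d) ℝ) (y : Fin n → ℝ) : ℝ :=
  y ⬝ᵥ ((1 - X * (Xᵀ * X)⁻¹ * Xᵀ) *ᵥ y)

/-- The integrand, as a function of `φ`, of the closed form of the Bayes factor; `R` stands for
the residual sum of squares of the model and `R0` for that of the reference model. -/
def bfIntegrand (n d d0 : ℕ) (R R0 φ : ℝ) : ℝ :=
  Real.sin φ ^ ((n : ℝ) - d0 - 1) * Real.cos φ ^ ((n : ℝ) - d - 1) *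
      ((n : ℝ) + Real.sin φ ^ 2) ^ (((n : ℝ) - d) / 2) /
    ((n : ℝ) * (R / R0) + Real.sin φ ^ 2) ^ (((n : ℝ) - d0) / 2)

end JPEP

end

/-! The Jeffreys prior is scale invariant, so integrating a Gaussian linear model of error variance
`κ v` against `c / v` gives a constant times `rss X y ^ (-(n - d) / 2)`, with a constant free of
`κ`. The likelihood (`κ = 1`) and the power likelihood (`κ = n`) therefore have the same marginal in
closed form, and dividing by the imaginary predictive of the larger model amounts to multiplying by
a power of `rss X` (`inv_baselinePredictive`).

The numerator thus becomes an integral over both variances `v`, `w`, both coefficient vectors `β`,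
`γ` and the imaginary sample `z`. By nesting, both means of `z` lie in the column space of `X`.
Completing the square keeps the centre there, where shifts do not change `rss X`, so the
`z`-integral is a moment of `rss X` under a centred Gaussian, that is, a moment of order `n - d` of
the norm on the `(n - d)`-dimensional orthogonal complement
(`lintegral_rss_rpow_mul_exp_sub_mulVec`). The integrals over `β` and then `γ` are Gaussian and
produce both residual sums of squares (`marginalLikelihood_jpepPrior`).

Substituting `w = v cot² φ` makes the integrand homogeneous in `v`. The `v`-integral is of
inverse-gamma type and leaves the stated integral over `φ`. Gram determinants are never evaluated:
`gramMass` of each design matrix cancels. Working in `[0, ∞]` makes every interchange an instance of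
Tonelli and covers `RSS_ℓ = 0`, where the remaining integrand behaves like `1 / φ` at zero. -/

namespace JPEP
open MeasureTheory

/-! ### Least squares and residual sums of squares -/

section LeastSquares

variable {n d : ℕ} {X : Matrix (Fin n) (Fin d) ℝ}

theorem mulVec_injective_of_rank_eq (h : X.rank = d) : Function.Injective X.mulVec := by
  have h1 := X.mulVecLin.finrank_range_add_finrank_ker
  rw [show Module.finrank ℝ (LinearMap.range X.mulVecLin) = d from h] at h1
  simp only [Module.finrank_fintype_fun_eq_card, Fintype.card_fin, Nat.add_eq_left] at h1
  have := LinearMap.ker_eq_bot.1 (Submodule.finrank_eq_zero.1 h1)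
  exact this

/-- Absent columns receive coefficient zero. This is how nesting enters: means of the reference
model lie in the column space of `X`. -/
theorem mulVec_submatrix_apply_extend {d0 : ℕ} (e : Fin d0 ↪ Fin d) (β : Fin d0 → ℝ) :
    X.submatrix id e *ᵥ β = X *ᵥ Function.extend e β 0 := by
  ext i
  simp only [Matrix.mulVec, dotProduct, Matrix.submatrix_apply, id]
  symm
  rw [← Finset.sum_subset (Finset.subset_univ (Finset.univ.map e))]
  · simp [e.injective.extend_apply]
  · intro j _ hj
    rw [Function.extend_apply', Pi.zero_apply, mul_zero]
    simpa using hj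

theorem mulVec_submatrix_injective {d0 : ℕ} (e : Fin d0 ↪ Fin d)
    (h : Function.Injective X.mulVec) : Function.Injective (X.submatrix id e).mulVec := by
  intro β γ hβ
  have h1 : X *ᵥ Function.extend e β 0 = X *ᵥ Function.extend e γ 0 := by
    rw [← mulVec_submatrix_apply_extend, ← mulVec_submatrix_apply_extend]
    exact hβ
  ext i
  have := congrFun (h h1) (e i)
  simpa [e.injective.extend_apply] using this

theorem isUnit_det_gram (h : Function.Injective X.mulVec) : IsUnit (Xᵀ * X).det := by
  rw [← Matrix.isUnit_iff_isUnit_det, ← Matrix.mulVec_injective_iff_isUnit]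
  intro β γ hβ
  have h0 : (Xᵀ * X) *ᵥ (β - γ) = 0 := by
    rw [Matrix.mulVec_sub, sub_eq_zero]; exact hβ
  have : (X *ᵥ (β - γ)) ⬝ᵥ (X *ᵥ (β - γ)) = 0 := by
    rw [Matrix.dotProduct_mulVec, ← Matrix.mulVec_transpose, Matrix.mulVec_mulVec, h0,
      zero_dotProduct]
  rw [dotProduct_self_eq_zero, Matrix.mulVec_sub, sub_eq_zero] at this
  exact h this

/-- The vector of least-squares coefficients of `y` on the columns of `X`. -/
noncomputable def leastSquares (X : Matrix (Fin n) (Fin d) ℝ) (y : Fin n → ℝ) : Fin d → ℝ :=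
  (Xᵀ * X)⁻¹ *ᵥ (Xᵀ *ᵥ y)

theorem transpose_mulVec_residual (h : Function.Injective X.mulVec) (y : Fin n → ℝ) :
    Xᵀ *ᵥ (y - X *ᵥ leastSquares X y) = 0 := by
  rw [Matrix.mulVec_sub, Matrix.mulVec_mulVec, leastSquares, Matrix.mulVec_mulVec,
    Matrix.mul_nonsing_inv _ (isUnit_det_gram h), Matrix.one_mulVec, sub_self]

theorem mulVec_dotProduct_residual (h : Function.Injective X.mulVec) (y : Fin n → ℝ)
    (β : Fin d → ℝ) : (X *ᵥ β) ⬝ᵥ (y - X *ᵥ leastSquares X y) = 0 := by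
  rw [dotProduct_comm, Matrix.dotProduct_mulVec, ← Matrix.mulVec_transpose,
    transpose_mulVec_residual h, zero_dotProduct]

theorem rss_eq_dotProduct (y : Fin n → ℝ) : rss X y = y ⬝ᵥ (y - X *ᵥ leastSquares X y) := by
  simp only [rss, leastSquares, Matrix.sub_mulVec, Matrix.one_mulVec, Matrix.mulVec_mulVec,
    Matrix.mul_assoc]

theorem rss_eq_residual (h : Function.Injective X.mulVec) (y : Fin n → ℝ) :
    rss X y = (y - X *ᵥ leastSquares X y) ⬝ᵥ (y - X *ᵥ leastSquares X y) := by
  rw [rss_eq_dotProduct, sub_dotProduct y, mulVec_dotProduct_residual h, sub_zero]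

theorem dotProduct_self_nonneg' {k : ℕ} (x : Fin k → ℝ) : 0 ≤ x ⬝ᵥ x :=
  Finset.sum_nonneg fun i _ => mul_self_nonneg (x i)

theorem rss_nonneg (h : Function.Injective X.mulVec) (y : Fin n → ℝ) : 0 ≤ rss X y := by
  rw [rss_eq_residual h]; exact dotProduct_self_nonneg' _

/-- Pythagoras: the squared distance of `y` to a point of the column space of `X`. -/
theorem dotProduct_self_sub_mulVec (h : Function.Injective X.mulVec) (y : Fin n → ℝ)
    (β : Fin d → ℝ) :
    (y - X *ᵥ β) ⬝ᵥ (y - X *ᵥ β) =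
      rss X y + (X *ᵥ (β - leastSquares X y)) ⬝ᵥ (X *ᵥ (β - leastSquares X y)) := by
  have h1 : y - X *ᵥ β = (y - X *ᵥ leastSquares X y) - X *ᵥ (β - leastSquares X y) := by
    rw [Matrix.mulVec_sub]; abel
  have h2 := mulVec_dotProduct_residual h y (β - leastSquares X y)
  rw [h1, rss_eq_residual h]
  generalize y - X *ᵥ leastSquares X y = r at *
  generalize X *ᵥ (β - leastSquares X y) = p at *
  rw [sub_dotProduct, dotProduct_sub, dotProduct_sub, dotProduct_comm r p, h2]
  ring

theorem rss_smul (r : ℝ) (y : Fin n → ℝ) : rss X (r • y) = r ^ 2 * rss X y := by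
  simp only [rss, Matrix.mulVec_smul, dotProduct_smul, smul_dotProduct, smul_eq_mul]
  ring

theorem leastSquares_add_mulVec (h : Function.Injective X.mulVec) (y : Fin n → ℝ)
    (β : Fin d → ℝ) : leastSquares X (y + X *ᵥ β) = leastSquares X y + β := by
  rw [leastSquares, leastSquares, Matrix.mulVec_add, Matrix.mulVec_add,
    Matrix.mulVec_mulVec β Xᵀ X, Matrix.mulVec_mulVec β, Matrix.nonsing_inv_mul _ (isUnit_det_gram h), Matrix.one_mulVec]

/-- The least-squares fit absorbs any shift along the column space, so the residual vector is
unchanged. -/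
theorem rss_add_mulVec (h : Function.Injective X.mulVec) (y : Fin n → ℝ) (β : Fin d → ℝ) :
    rss X (y + X *ᵥ β) = rss X y := by
  rw [rss_eq_residual h, rss_eq_residual h, leastSquares_add_mulVec h, Matrix.mulVec_add]
  simp

theorem continuous_rss : Continuous (rss X) := by
  unfold rss
  exact Continuous.dotProduct continuous_id (Continuous.matrix_mulVec continuous_const continuous_id)

end LeastSquares

/-! ### Gaussian integrals over samples and coefficients -/

section Gaussian

theorem lintegral_comp_smul_pi {k : ℕ} (g : (Fin k → ℝ) → ℝ≥0∞) {r : ℝ} (hr : 0 < r) :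
    ∫⁻ x, g (r • x) = ENNReal.ofReal (r ^ (-(k : ℝ))) * ∫⁻ x, g x := by
  have h := Measure.map_addHaar_smul (volume : Measure (Fin k → ℝ)) hr.ne'
  have h2 : ∫⁻ x, g x ∂(Measure.map (r • ·) (volume : Measure (Fin k → ℝ))) = ∫⁻ x, g (r • x) :=
    lintegral_map_equiv g (Homeomorph.smulOfNeZero r hr.ne').toMeasurableEquiv
  rw [← h2, h, lintegral_smul_measure, smul_eq_mul]
  congr 2
  rw [Module.finrank_fintype_fun_eq_card, Fintype.card_fin, Real.rpow_neg hr.le,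
    Real.rpow_natCast, abs_of_pos (by positivity)]

theorem lintegral_exp_neg_dotProduct_self {k : ℕ} {s : ℝ} (hs : 0 < s) :
    ∫⁻ x : Fin k → ℝ, ENNReal.ofReal (Real.exp (-(s * (x ⬝ᵥ x)))) =
      ENNReal.ofReal ((Real.pi / s) ^ ((k : ℝ) / 2)) := by
  have h1 : ∫⁻ x : EuclideanSpace ℝ (Fin k), ENNReal.ofReal (Real.exp (-s * ‖x‖ ^ 2)) =
      ENNReal.ofReal ((Real.pi / s) ^ ((k : ℝ) / 2)) := by
    have h2 := GaussianFourier.integral_rexp_neg_mul_sq_norm (V := EuclideanSpace ℝ (Fin k)) hs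
    rw [finrank_euclideanSpace_fin] at h2
    rw [← h2, ofReal_integral_eq_lintegral_ofReal]
    -- The Bochner integral of a non-integrable function is `0` by convention, so a nonzero value
    -- forces integrability.
    · by_contra hc
      rw [integral_undef hc] at h2
      have : 0 < (Real.pi / s) ^ ((k : ℝ) / 2) := by positivity
      exact this.ne h2
    · filter_upwards with x using (Real.exp_pos _).le
  rw [← h1, ← (PiLp.volume_preserving_toLp (Fin k)).lintegral_comp_emb
    (MeasurableEquiv.toLp 2 _).measurableEmbedding]
  refine lintegral_congr fun x => ?_
  rw [EuclideanSpace.real_norm_sq_eq]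
  simp [dotProduct, sq]

variable {n d : ℕ} {X : Matrix (Fin n) (Fin d) ℝ}

/-- An injective linear map in finite dimension is bounded below. The bound makes `gramMass` finite
by comparison with an isotropic Gaussian. -/
theorem exists_dotProduct_self_le_mulVec (h : Function.Injective X.mulVec) :
    ∃ ε : ℝ, 0 < ε ∧ ∀ β, ε * (β ⬝ᵥ β) ≤ (X *ᵥ β) ⬝ᵥ (X *ᵥ β) := by
  have hker : LinearMap.ker X.mulVecLin = ⊥ := LinearMap.ker_eq_bot.2 h
  obtain ⟨K, hK, hanti⟩ := LinearMap.exists_antilipschitzWith X.mulVecLin hker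
  have hK' : (0 : ℝ) < K := hK
  -- The factor `d` compares the Euclidean and sup norms; `d + 1` keeps the denominator positive
  -- when `d = 0`.
  refine ⟨1 / ((d + 1) * (K : ℝ) ^ 2), by positivity, fun β => ?_⟩
  have h1 : ‖β‖ ≤ K * ‖X *ᵥ β‖ := by
    have := hanti.le_mul_dist β 0
    simpa using this
  have h2 : β ⬝ᵥ β ≤ d * ‖β‖ ^ 2 := by
    have : ∀ i ∈ Finset.univ, β i * β i ≤ ‖β‖ ^ 2 := fun i _ => by
      have := norm_le_pi_norm β i
      rw [← sq, ← sq_abs]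
      exact pow_le_pow_left₀ (abs_nonneg _) this 2
    simpa [dotProduct] using Finset.sum_le_sum this
  have h3 : ‖X *ᵥ β‖ ^ 2 ≤ (X *ᵥ β) ⬝ᵥ (X *ᵥ β) := by
    have hnn := dotProduct_self_nonneg' (X *ᵥ β)
    rw [← Real.le_sqrt (norm_nonneg _) hnn, pi_norm_le_iff_of_nonneg (Real.sqrt_nonneg _)]
    intro i
    rw [Real.norm_eq_abs]
    apply Real.abs_le_sqrt
    rw [sq]
    exact Finset.single_le_sum (f := fun i => (X *ᵥ β) i * (X *ᵥ β) i)
      (fun i _ => mul_self_nonneg _) (Finset.mem_univ i)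
  have h4 : ‖β‖ ^ 2 ≤ K ^ 2 * ‖X *ᵥ β‖ ^ 2 := by
    rw [← mul_pow]; exact pow_le_pow_left₀ (norm_nonneg _) h1 2
  rw [div_mul_eq_mul_div, one_mul, div_le_iff₀ (by positivity)]
  calc β ⬝ᵥ β ≤ d * ‖β‖ ^ 2 := h2
    _ ≤ (d + 1) * (K ^ 2 * ((X *ᵥ β) ⬝ᵥ (X *ᵥ β))) := by
      have : (K : ℝ) ^ 2 * ‖X *ᵥ β‖ ^ 2 ≤ K ^ 2 * ((X *ᵥ β) ⬝ᵥ (X *ᵥ β)) := by gcongr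
      gcongr
      · linarith
      · linarith
    _ = _ := by ring

/-- The integral of `exp (-|X β|²)` over the coefficients `β`. -/
noncomputable def gramMass (X : Matrix (Fin n) (Fin d) ℝ) : ℝ :=
  (∫⁻ β : Fin d → ℝ, ENNReal.ofReal (Real.exp (-((X *ᵥ β) ⬝ᵥ (X *ᵥ β))))).toReal

theorem continuous_dotProduct_self_mulVec :
    Continuous fun β : Fin d → ℝ => (X *ᵥ β) ⬝ᵥ (X *ᵥ β) :=
  (Continuous.matrix_mulVec continuous_const continuous_id).dotProduct
    (Continuous.matrix_mulVec continuous_const continuous_id)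

theorem lintegral_gram_ne_top (h : Function.Injective X.mulVec) :
    ∫⁻ β : Fin d → ℝ, ENNReal.ofReal (Real.exp (-((X *ᵥ β) ⬝ᵥ (X *ᵥ β)))) ≠ ⊤ := by
  obtain ⟨ε, hε, hle⟩ := exists_dotProduct_self_le_mulVec h
  refine ne_top_of_le_ne_top ?_ (lintegral_mono (g := fun β : Fin d → ℝ =>
    ENNReal.ofReal (Real.exp (-(ε * (β ⬝ᵥ β))))) fun β => ?_)
  · rw [lintegral_exp_neg_dotProduct_self hε]; exact ENNReal.ofReal_ne_top
  · exact ENNReal.ofReal_le_ofReal (Real.exp_le_exp.2 (neg_le_neg (hle β)))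

theorem ofReal_gramMass (h : Function.Injective X.mulVec) :
    ENNReal.ofReal (gramMass X) =
      ∫⁻ β : Fin d → ℝ, ENNReal.ofReal (Real.exp (-((X *ᵥ β) ⬝ᵥ (X *ᵥ β)))) :=
  ENNReal.ofReal_toReal (lintegral_gram_ne_top h)

theorem gramMass_pos (h : Function.Injective X.mulVec) : 0 < gramMass X := by
  refine ENNReal.toReal_pos ?_ (lintegral_gram_ne_top h)
  have hm : Measurable fun β : Fin d → ℝ =>
      ENNReal.ofReal (Real.exp (-((X *ᵥ β) ⬝ᵥ (X *ᵥ β)))) :=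
    (Real.measurable_exp.comp continuous_dotProduct_self_mulVec.measurable.neg).ennreal_ofReal
  rw [← pos_iff_ne_zero, lintegral_pos_iff_support hm]
  have : Function.support (fun β : Fin d → ℝ =>
      ENNReal.ofReal (Real.exp (-((X *ᵥ β) ⬝ᵥ (X *ᵥ β))))) = Set.univ := by
    ext β; simp [Real.exp_pos]
  rw [this]
  exact isOpen_univ.measure_pos _ Set.univ_nonempty

/-- The Gaussian integral over the coefficients of a linear model of full column rank. -/
theorem lintegral_exp_neg_sub_mulVec (h : Function.Injective X.mulVec) {s : ℝ} (hs : 0 < s)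
    (y : Fin n → ℝ) :
    ∫⁻ β : Fin d → ℝ, ENNReal.ofReal (Real.exp (-(s * ((y - X *ᵥ β) ⬝ᵥ (y - X *ᵥ β))))) =
      ENNReal.ofReal (gramMass X * s ^ (-(d : ℝ) / 2) * Real.exp (-(s * rss X y))) := by
  have h1 : ∀ β : Fin d → ℝ,
      ENNReal.ofReal (Real.exp (-(s * ((y - X *ᵥ β) ⬝ᵥ (y - X *ᵥ β))))) =
      ENNReal.ofReal (Real.exp (-(s * rss X y))) * (fun γ : Fin d → ℝ =>
        ENNReal.ofReal (Real.exp (-((X *ᵥ (√s • γ)) ⬝ᵥ (X *ᵥ (√s • γ))))))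
        (β - leastSquares X y) := fun β => by
    rw [← ENNReal.ofReal_mul (Real.exp_pos _).le, ← Real.exp_add,
      dotProduct_self_sub_mulVec h, Matrix.mulVec_smul, dotProduct_smul, smul_dotProduct,
      smul_eq_mul, smul_eq_mul, ← mul_assoc, Real.mul_self_sqrt hs.le]
    congr 2; ring
  simp_rw [h1]
  rw [lintegral_const_mul' _ _ ENNReal.ofReal_ne_top,
    lintegral_sub_right_eq_self (fun γ : Fin d → ℝ =>
      ENNReal.ofReal (Real.exp (-((X *ᵥ (√s • γ)) ⬝ᵥ (X *ᵥ (√s • γ)))))),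
    lintegral_comp_smul_pi (fun γ : Fin d → ℝ =>
      ENNReal.ofReal (Real.exp (-((X *ᵥ γ) ⬝ᵥ (X *ᵥ γ))))) (Real.sqrt_pos.2 hs),
    ← ofReal_gramMass h, ← ENNReal.ofReal_mul (by positivity),
    ← ENNReal.ofReal_mul (by positivity)]
  congr 1
  rw [Real.sqrt_eq_rpow, ← Real.rpow_mul hs.le]
  rw [show (1 / 2 : ℝ) * -(d : ℝ) = -(d : ℝ) / 2 by ring]
  ring

end Gaussian

/-! ### Radial Gaussian moments -/

section RadialMoment

variable {V : Type*} [NormedAddCommGroup V] [InnerProductSpace ℝ V] [FiniteDimensional ℝ V]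
  [MeasurableSpace V] [BorelSpace V]

theorem lintegral_exp_neg_norm_sq : ∫⁻ z : V, ENNReal.ofReal (Real.exp (-‖z‖ ^ 2)) =
    ENNReal.ofReal (Real.pi ^ ((Module.finrank ℝ V : ℝ) / 2)) := by
  have h2 := GaussianFourier.integral_rexp_neg_mul_sq_norm (V := V) one_pos
  simp only [div_one, neg_mul, one_mul] at h2
  rw [← h2, ofReal_integral_eq_lintegral_ofReal]
  · by_contra hc
    rw [integral_undef hc] at h2
    have : 0 < Real.pi ^ ((Module.finrank ℝ V : ℝ) / 2) := by positivity
    exact this.ne h2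
  · filter_upwards with x using (Real.exp_pos _).le

/-- The moment of order `dim V` of the norm under the Gaussian weight `exp (-‖z‖²)`. -/
theorem lintegral_norm_rpow_finrank_mul_exp [Nontrivial V] :
    ∫⁻ z : V, ENNReal.ofReal (‖z‖ ^ (Module.finrank ℝ V : ℝ) * Real.exp (-‖z‖ ^ 2)) =
      ENNReal.ofReal (Real.pi ^ ((Module.finrank ℝ V : ℝ) / 2) *
        Real.Gamma (Module.finrank ℝ V) / Real.Gamma ((Module.finrank ℝ V : ℝ) / 2)) := by
  set m := Module.finrank ℝ V with hm
  have hm1 : 0 < m := Module.finrank_pos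
  have hmr : (0 : ℝ) < m := by exact_mod_cast hm1
  have e1 : ∫ z : V, Real.exp (-‖z‖ ^ 2) = Real.pi ^ ((m : ℝ) / 2) := by
    have h2 := GaussianFourier.integral_rexp_neg_mul_sq_norm (V := V) one_pos
    simpa only [div_one, neg_mul, one_mul] using h2
  -- In polar coordinates `e2` and `e3` carry the same unit-ball volume, which drops out once `e1`
  -- is used.
  have e2 := integral_fun_norm_addHaar (volume : Measure V) (fun r => Real.exp (-r ^ 2))
  have e3 := integral_fun_norm_addHaar (volume : Measure V)
    (fun r => r ^ (m : ℝ) * Real.exp (-r ^ 2))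
  have g1 : ∫ r in Set.Ioi (0 : ℝ), r ^ (m - 1) • Real.exp (-r ^ 2) =
      1 / 2 * Real.Gamma ((m : ℝ) / 2) := by
    have := integral_rpow_mul_exp_neg_rpow (p := 2) (q := (m : ℝ) - 1) two_pos (by linarith)
    rw [sub_add_cancel] at this
    rw [← this]
    refine setIntegral_congr_fun measurableSet_Ioi fun r hr => ?_
    simp only [smul_eq_mul, Real.rpow_two]
    rw [← Real.rpow_natCast, Nat.cast_sub hm1, Nat.cast_one]
  have g2 : ∫ r in Set.Ioi (0 : ℝ), r ^ (m - 1) • (r ^ (m : ℝ) * Real.exp (-r ^ 2)) =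
      1 / 2 * Real.Gamma m := by
    have := integral_rpow_mul_exp_neg_rpow (p := 2) (q := 2 * (m : ℝ) - 1) two_pos (by linarith)
    rw [sub_add_cancel, mul_div_cancel_left₀ _ (two_ne_zero)] at this
    rw [← this]
    refine setIntegral_congr_fun measurableSet_Ioi fun r hr => ?_
    simp only [smul_eq_mul, Real.rpow_two]
    rw [← Real.rpow_natCast, Nat.cast_sub hm1, Nat.cast_one, ← mul_assoc, ← Real.rpow_add hr]
    congr 2; ring
  rw [e1, ← hm, g1] at e2
  rw [← hm, g2] at e3
  have hG : 0 < Real.Gamma ((m : ℝ) / 2) := Real.Gamma_pos_of_pos (by linarith)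
  have hG2 : 0 < Real.Gamma (m : ℝ) := Real.Gamma_pos_of_pos hmr
  have e4 : ∫ z : V, ‖z‖ ^ (m : ℝ) * Real.exp (-‖z‖ ^ 2) =
      Real.pi ^ ((m : ℝ) / 2) * Real.Gamma m / Real.Gamma ((m : ℝ) / 2) := by
    rw [e3, e2]
    simp only [nsmul_eq_mul, smul_eq_mul]
    field_simp
  rw [← e4, ofReal_integral_eq_lintegral_ofReal]
  · by_contra hc
    rw [integral_undef hc] at e4
    have : 0 < Real.pi ^ ((m : ℝ) / 2) * Real.Gamma m / Real.Gamma ((m : ℝ) / 2) := by positivity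
    exact this.ne e4
  · filter_upwards with x using by positivity

end RadialMoment

/-! ### Moments of the residual sum of squares -/

section ResidualMoment

variable {n d : ℕ} {X : Matrix (Fin n) (Fin d) ℝ}

theorem rss_of_transpose_mulVec_eq_zero {z : Fin n → ℝ} (hz : Xᵀ *ᵥ z = 0) :
    rss X z = z ⬝ᵥ z := by
  rw [rss_eq_dotProduct, leastSquares, hz, Matrix.mulVec_zero, Matrix.mulVec_zero, sub_zero]

/-- Splitting of Lebesgue measure along the column space of `X` and its orthogonal complement,
for functions of the residual sum of squares. -/
theorem exists_lintegral_rss_eq (h : Function.Injective X.mulVec) :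
    ∃ (V : Submodule ℝ (EuclideanSpace ℝ (Fin n))) (κ : ℝ≥0∞), Module.finrank ℝ V + d = n ∧
      ∀ g : ℝ → ℝ, Measurable g →
        ∫⁻ y : Fin n → ℝ, ENNReal.ofReal (g (rss X y) * Real.exp (-(y ⬝ᵥ y))) =
          κ * ∫⁻ z : V, ENNReal.ofReal (g (‖z‖ ^ 2) * Real.exp (-‖z‖ ^ 2)) := by
  let L : (Fin d → ℝ) →ₗ[ℝ] EuclideanSpace ℝ (Fin n) :=
    (WithLp.linearEquiv 2 ℝ (Fin n → ℝ)).symm.toLinearMap ∘ₗ X.mulVecLin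
  have hL : ∀ β, L β = WithLp.toLp 2 (X *ᵥ β) := fun β => rfl
  have hLinj : Function.Injective L :=
    (WithLp.linearEquiv 2 ℝ (Fin n → ℝ)).symm.injective.comp h
  let K := LinearMap.range L
  have hinj : Function.Injective (L.coprod Kᗮ.subtype) := by
    rw [← LinearMap.ker_eq_bot, LinearMap.ker_coprod_of_disjoint_range, LinearMap.ker_eq_bot.2 hLinj,
      Submodule.ker_subtype, Submodule.prod_bot]
    rw [Submodule.range_subtype]
    exact K.orthogonal_disjoint
  have hsurj : Function.Surjective (L.coprod Kᗮ.subtype) := by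
    rw [← LinearMap.range_eq_top, LinearMap.range_coprod, Submodule.range_subtype]
    exact K.sup_orthogonal_of_hasOrthogonalProjection
  let Φ := (LinearEquiv.ofBijective _ ⟨hinj, hsurj⟩).toContinuousLinearEquiv
  have hΦ : ∀ p, Φ p = L p.1 + p.2 := fun p => rfl
  let μ : Measure (EuclideanSpace ℝ (Fin n)) := Measure.map Φ (volume.prod volume)
  have : μ.IsAddHaarMeasure := ContinuousLinearEquiv.isAddHaarMeasure_map Φ _
  -- By uniqueness of Haar measure, Lebesgue measure is a multiple of the transported product
  -- measure; the factor is left unevaluated.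
  have hvol := Measure.isAddLeftInvariant_eq_smul
    (volume : Measure (EuclideanSpace ℝ (Fin n))) μ
  set κ := Measure.addHaarScalarFactor (volume : Measure (EuclideanSpace ℝ (Fin n))) μ
  refine ⟨Kᗮ, κ * ENNReal.ofReal (gramMass X), ?_, fun g hg => ?_⟩
  · have h1 := K.finrank_add_finrank_orthogonal
    rw [LinearMap.finrank_range_of_inj hLinj, finrank_euclideanSpace_fin,
      Module.finrank_fintype_fun_eq_card, Fintype.card_fin] at h1
    omega
  have horth : ∀ z : Kᗮ, Xᵀ *ᵥ WithLp.ofLp (z : EuclideanSpace ℝ (Fin n)) = 0 := fun z => by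
    -- Testing orthogonality of `z` against `X Xᵀ z` gives `|Xᵀ z|² = 0`.
    have h1 := (Submodule.mem_orthogonal _ _).1 z.2
      (L (Xᵀ *ᵥ WithLp.ofLp (z : EuclideanSpace ℝ (Fin n)))) ⟨_, rfl⟩
    rw [hL, EuclideanSpace.inner_eq_star_dotProduct] at h1
    simp only [star_trivial] at h1
    rw [Matrix.dotProduct_mulVec, ← Matrix.mulVec_transpose] at h1
    exact dotProduct_self_eq_zero.1 h1
  have hnorm : ∀ z : Kᗮ, ‖z‖ ^ 2 = WithLp.ofLp (z : EuclideanSpace ℝ (Fin n)) ⬝ᵥ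
      WithLp.ofLp (z : EuclideanSpace ℝ (Fin n)) := fun z => by
    change ‖(z : EuclideanSpace ℝ (Fin n))‖ ^ 2 = _
    rw [EuclideanSpace.real_norm_sq_eq]
    simp [dotProduct, sq]
  have hrss : ∀ p : (Fin d → ℝ) × Kᗮ, rss X (WithLp.ofLp (Φ p)) = ‖p.2‖ ^ 2 := fun p => by
    rw [hΦ, hL, WithLp.ofLp_add, add_comm, rss_add_mulVec h,
      rss_of_transpose_mulVec_eq_zero (horth _), hnorm]
  have hsq : ∀ p : (Fin d → ℝ) × Kᗮ, WithLp.ofLp (Φ p) ⬝ᵥ WithLp.ofLp (Φ p) =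
      (X *ᵥ p.1) ⬝ᵥ (X *ᵥ p.1) + ‖p.2‖ ^ 2 := fun p => by
    have h1 : WithLp.ofLp (p.2 : EuclideanSpace ℝ (Fin n)) ⬝ᵥ (X *ᵥ p.1) = 0 := by
      rw [Matrix.dotProduct_mulVec, ← Matrix.mulVec_transpose, horth, zero_dotProduct]
    have h2 : (X *ᵥ p.1) ⬝ᵥ WithLp.ofLp (p.2 : EuclideanSpace ℝ (Fin n)) = 0 := by
      rw [dotProduct_comm, h1]
    rw [hΦ, hL, WithLp.ofLp_add, hnorm]
    simp only [add_dotProduct, dotProduct_add, h1, h2]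
    ring
  have hmeas : Measurable fun z : Kᗮ => ENNReal.ofReal (g (‖z‖ ^ 2) * Real.exp (-‖z‖ ^ 2)) := by
    fun_prop
  rw [← (PiLp.volume_preserving_ofLp (Fin n)).lintegral_comp_emb
    (MeasurableEquiv.toLp 2 _).symm.measurableEmbedding, hvol, lintegral_smul_measure]
  have hmap := lintegral_map_equiv (μ := (volume : Measure (Fin d → ℝ)).prod
    (volume : Measure Kᗮ)) (fun x : EuclideanSpace ℝ (Fin n) =>
      ENNReal.ofReal (g (rss X (WithLp.ofLp x)) * Real.exp (-(WithLp.ofLp x ⬝ᵥ WithLp.ofLp x))))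
    Φ.toHomeomorph.toMeasurableEquiv
  have hmap' : ∫⁻ x : EuclideanSpace ℝ (Fin n), ENNReal.ofReal
      (g (rss X (WithLp.ofLp x)) * Real.exp (-(WithLp.ofLp x ⬝ᵥ WithLp.ofLp x))) ∂μ =
      ENNReal.ofReal (gramMass X) *
        ∫⁻ z : Kᗮ, ENNReal.ofReal (g (‖z‖ ^ 2) * Real.exp (-‖z‖ ^ 2)) := by
    refine hmap.trans ?_
    rw [ofReal_gramMass h, ← lintegral_prod_mul _ hmeas.aemeasurable]
    · refine lintegral_congr fun p => ?_
      change ENNReal.ofReal (g (rss X (WithLp.ofLp (Φ p))) *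
        Real.exp (-(WithLp.ofLp (Φ p) ⬝ᵥ WithLp.ofLp (Φ p)))) = _
      rw [hrss, hsq, ← ENNReal.ofReal_mul (Real.exp_pos _).le, neg_add, Real.exp_add]
      congr 1; ring
    · exact (Real.measurable_exp.comp
        continuous_dotProduct_self_mulVec.measurable.neg).ennreal_ofReal.aemeasurable
  rw [hmap', mul_assoc]
  rfl

theorem lintegral_rss_rpow_mul_exp (h : Function.Injective X.mulVec) (hd : d < n) :
    ∫⁻ y : Fin n → ℝ, ENNReal.ofReal
        (rss X y ^ (((n : ℝ) - d) / 2) * Real.exp (-(y ⬝ᵥ y))) =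
      ENNReal.ofReal (Real.pi ^ ((n : ℝ) / 2) * Real.Gamma ((n : ℝ) - d) /
        Real.Gamma (((n : ℝ) - d) / 2)) := by
  obtain ⟨V, κ, hV, hg⟩ := exists_lintegral_rss_eq h
  have hVr : (Module.finrank ℝ V : ℝ) = (n : ℝ) - d := by
    rw [eq_sub_iff_add_eq]; exact_mod_cast hV
  have : Nontrivial V := Module.nontrivial_of_finrank_pos (R := ℝ) (by omega)
  have hm : (0 : ℝ) < (n : ℝ) - d := by rw [sub_pos]; exact_mod_cast hd
  have hG : 0 < Real.Gamma (((n : ℝ) - d) / 2) := Real.Gamma_pos_of_pos (by linarith)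
  have hG2 : 0 < Real.Gamma ((n : ℝ) - d) := Real.Gamma_pos_of_pos hm
  -- The constant function determines `κ` through the known Gaussian integral over the whole space.
  have h1 := hg (fun _ => 1) measurable_const
  have h2 := hg (fun x => x ^ (((n : ℝ) - d) / 2)) (by fun_prop)
  have h3 := lintegral_exp_neg_dotProduct_self (k := n) one_pos
  simp only [one_mul, div_one] at h1 h3
  rw [h3, lintegral_exp_neg_norm_sq, hVr] at h1
  have h4 : ∀ z : V, (‖z‖ ^ 2) ^ (((n : ℝ) - d) / 2) = ‖z‖ ^ (Module.finrank ℝ V : ℝ) := fun z => by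
    rw [← Real.rpow_natCast, ← Real.rpow_mul (norm_nonneg _), hVr]
    congr 1; push_cast; ring
  simp only [h4, lintegral_norm_rpow_finrank_mul_exp] at h2
  rw [h2, hVr, mul_div_assoc, ENNReal.ofReal_mul (by positivity), ← mul_assoc, ← h1,
    ← ENNReal.ofReal_mul (by positivity), mul_div_assoc]

/-- The moment of `rss X` under an isotropic Gaussian weight centred in the column space. -/
theorem lintegral_rss_rpow_mul_exp_sub_mulVec (h : Function.Injective X.mulVec) (hd : d < n)
    {s : ℝ} (hs : 0 < s) (γ : Fin d → ℝ) :
    ∫⁻ y : Fin n → ℝ, ENNReal.ofReal (rss X y ^ (((n : ℝ) - d) / 2) *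
        Real.exp (-(s * ((y - X *ᵥ γ) ⬝ᵥ (y - X *ᵥ γ))))) =
      ENNReal.ofReal (Real.pi ^ ((n : ℝ) / 2) * Real.Gamma ((n : ℝ) - d) /
        Real.Gamma (((n : ℝ) - d) / 2) * s ^ (-(n : ℝ) / 2 - ((n : ℝ) - d) / 2)) := by
  have hm : (0 : ℝ) < (n : ℝ) - d := by rw [sub_pos]; exact_mod_cast hd
  have hG : 0 < Real.Gamma (((n : ℝ) - d) / 2) := Real.Gamma_pos_of_pos (by linarith)
  have hG2 : 0 < Real.Gamma ((n : ℝ) - d) := Real.Gamma_pos_of_pos hm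
  set a := ((n : ℝ) - d) / 2
  have h1 : ∀ y : Fin n → ℝ, ENNReal.ofReal (rss X y ^ a *
        Real.exp (-(s * ((y - X *ᵥ γ) ⬝ᵥ (y - X *ᵥ γ))))) =
      (fun x : Fin n → ℝ => ENNReal.ofReal (s ^ (-a)) * ENNReal.ofReal (rss X (√s • x) ^ a *
        Real.exp (-((√s • x) ⬝ᵥ (√s • x))))) (y - X *ᵥ γ) := fun y => by
    have hr : rss X y = rss X (y - X *ᵥ γ) := by
      rw [← rss_add_mulVec h (y - X *ᵥ γ) γ, sub_add_cancel]
    have hnn := rss_nonneg h (y - X *ᵥ γ)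
    simp only
    rw [hr, ← ENNReal.ofReal_mul (by positivity), rss_smul, dotProduct_smul, smul_dotProduct,
      smul_eq_mul, smul_eq_mul, ← mul_assoc √s, Real.mul_self_sqrt hs.le, Real.sq_sqrt hs.le,
      Real.mul_rpow hs.le hnn, ← mul_assoc, ← mul_assoc, ← Real.rpow_add hs, neg_add_cancel,
      Real.rpow_zero, one_mul]
  simp_rw [h1]
  rw [lintegral_sub_right_eq_self (fun x : Fin n → ℝ => ENNReal.ofReal (s ^ (-a)) *
      ENNReal.ofReal (rss X (√s • x) ^ a * Real.exp (-((√s • x) ⬝ᵥ (√s • x))))),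
    lintegral_const_mul' _ _ ENNReal.ofReal_ne_top,
    lintegral_comp_smul_pi (fun x : Fin n → ℝ =>
      ENNReal.ofReal (rss X x ^ a * Real.exp (-(x ⬝ᵥ x)))) (Real.sqrt_pos.2 hs),
    lintegral_rss_rpow_mul_exp h hd, ← ENNReal.ofReal_mul (by positivity),
    ← ENNReal.ofReal_mul (by positivity)]
  congr 1
  rw [Real.sqrt_eq_rpow, ← Real.rpow_mul hs.le, ← mul_assoc, ← Real.rpow_add hs, mul_comm]
  congr 2
  ring

end ResidualMoment

/-! ### Closed forms of the likelihood and the power likelihood -/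

section Likelihood

variable {n d : ℕ} {X : Matrix (Fin n) (Fin d) ℝ}

theorem normalDensity_smul_one (μ y : Fin n → ℝ) {v : ℝ} (hv : 0 < v) :
    normalDensity μ (v • (1 : Matrix (Fin n) (Fin n) ℝ)) y =
      (2 * Real.pi * v) ^ (-(n : ℝ) / 2) *
        Real.exp (-(1 / (2 * v) * ((y - μ) ⬝ᵥ (y - μ)))) := by
  have hinv : (v • (1 : Matrix (Fin n) (Fin n) ℝ))⁻¹ = v⁻¹ • 1 := by
    apply Matrix.inv_eq_left_inv
    rw [smul_mul_smul_comm, inv_mul_cancel₀ hv.ne', one_mul, one_smul]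
  rw [normalDensity, hinv, Matrix.det_smul, Matrix.det_one, mul_one, Fintype.card_fin,
    Matrix.smul_mulVec, Matrix.one_mulVec, dotProduct_smul, smul_eq_mul,
    Real.mul_rpow (by positivity) hv.le, ← Real.rpow_natCast, ← Real.rpow_mul hv.le]
  congr 2
  · ring_nf
  · field_simp

theorem likelihood_eq (β : Fin d → ℝ) {v : ℝ} (hv : 0 < v) (y : Fin n → ℝ) :
    likelihood X β v y = ENNReal.ofReal ((2 * Real.pi * v) ^ (-(n : ℝ) / 2) *
        Real.exp (-(1 / (2 * v) * ((y - X *ᵥ β) ⬝ᵥ (y - X *ᵥ β))))) := by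
  rw [likelihood, normalDensity_smul_one _ _ hv]

/-- With power parameter `n`, the power likelihood is the likelihood with variance `n v`. -/
theorem powerLikelihood_eq (hn : 0 < n) (β : Fin d → ℝ) {v : ℝ} (hv : 0 < v) (y : Fin n → ℝ) :
    powerLikelihood X (n : ℝ) β v y = ENNReal.ofReal ((2 * Real.pi * (n * v)) ^ (-(n : ℝ) / 2) *
        Real.exp (-(1 / (2 * (n * v)) * ((y - X *ᵥ β) ⬝ᵥ (y - X *ᵥ β))))) := by
  have hn' : (0 : ℝ) < n := by exact_mod_cast hn
  -- The power `1 / n` multiplies the variance by `n` in the exponential; the prefactor is constant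
  -- in `z` and cancels in the normalization.
  have h1 : ∀ z : Fin n → ℝ, likelihood X β v z ^ (1 / (n : ℝ)) =
      ENNReal.ofReal ((2 * Real.pi * v) ^ (-(1 : ℝ) / 2)) * (fun x : Fin n → ℝ =>
        ENNReal.ofReal (Real.exp (-(1 / (2 * (n * v)) * (x ⬝ᵥ x))))) (z - X *ᵥ β) := fun z => by
    rw [likelihood_eq β hv, ENNReal.ofReal_rpow_of_nonneg (by positivity) (by positivity),
      Real.mul_rpow (by positivity) (by positivity), ← Real.rpow_mul (by positivity),
      ← Real.exp_mul, ← ENNReal.ofReal_mul (by positivity)]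
    congr 3
    · field_simp
    · field_simp
  have h2 : ENNReal.ofReal ((2 * Real.pi * v) ^ (-(1 : ℝ) / 2)) ≠ 0 := by
    rw [Ne, ENNReal.ofReal_eq_zero, not_le]; positivity
  have h3 : ENNReal.ofReal ((Real.pi / (1 / (2 * (n * v)))) ^ ((n : ℝ) / 2)) ≠ 0 := by
    rw [Ne, ENNReal.ofReal_eq_zero, not_le]; positivity
  rw [powerLikelihood]
  simp_rw [h1]
  rw [lintegral_const_mul' _ _ ENNReal.ofReal_ne_top,
    lintegral_sub_right_eq_self (fun x : Fin n → ℝ =>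
        ENNReal.ofReal (Real.exp (-(1 / (2 * (n * v)) * (x ⬝ᵥ x))))),
    lintegral_exp_neg_dotProduct_self (by positivity),
    ENNReal.mul_div_mul_left _ _ h2 ENNReal.ofReal_ne_top,
    ← ENNReal.ofReal_div_of_pos (by positivity)]
  congr 1
  rw [neg_div, Real.rpow_neg (by positivity), div_eq_inv_mul]
  congr 3
  field_simp

end Likelihood

/-! ### Inverse-gamma integrals over a variance -/

section InverseGamma

theorem lintegral_Ioi_comp_inv (g : ℝ → ℝ≥0∞) :
    ∫⁻ v in Set.Ioi (0 : ℝ), g v = ∫⁻ u in Set.Ioi (0 : ℝ), ENNReal.ofReal (u ^ 2)⁻¹ * g u⁻¹ := by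
  have himg : (fun u : ℝ => u⁻¹) '' Set.Ioi 0 = Set.Ioi 0 := by
    ext x
    simp only [Set.mem_image, Set.mem_Ioi]
    exact ⟨fun ⟨u, hu, hx⟩ => hx ▸ inv_pos.2 hu, fun hx => ⟨x⁻¹, inv_pos.2 hx, inv_inv x⟩⟩
  have h := lintegral_image_eq_lintegral_abs_deriv_mul (s := Set.Ioi (0 : ℝ))
    (f := fun u : ℝ => u⁻¹) (f' := fun u => -(u ^ 2)⁻¹) measurableSet_Ioi
    (fun u hu => (hasDerivAt_inv (ne_of_gt hu)).hasDerivWithinAt) inv_injective.injOn g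
  rw [himg] at h
  rw [h]
  simp only [abs_neg, abs_inv, abs_pow, sq_abs]

theorem lintegral_rpow_mul_exp_neg_div {a R : ℝ} (ha : 0 < a) (hR : 0 < R) :
    ∫⁻ v in Set.Ioi (0 : ℝ), ENNReal.ofReal (v ^ (-a - 1) * Real.exp (-(R / v))) =
      ENNReal.ofReal (Real.Gamma a * R ^ (-a)) := by
  have h1 := Real.integral_rpow_mul_exp_neg_mul_Ioi ha hR
  have hG := Real.Gamma_pos_of_pos ha
  have h2 : (1 / R) ^ a * Real.Gamma a = Real.Gamma a * R ^ (-a) := by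
    rw [Real.rpow_neg hR.le, one_div, Real.inv_rpow hR.le, mul_comm]
  rw [← h2, ← h1, ofReal_integral_eq_lintegral_ofReal, lintegral_Ioi_comp_inv]
  · refine setLIntegral_congr_fun measurableSet_Ioi fun u hu => ?_
    have hu' : 0 < u := hu
    rw [← ENNReal.ofReal_mul (by positivity), ← mul_assoc, Real.inv_rpow hu'.le,
      ← Real.rpow_neg hu'.le, ← Real.rpow_natCast u 2, ← Real.rpow_neg hu'.le,
      ← Real.rpow_add hu', div_inv_eq_mul]
    congr 3
    push_cast; ring
  · by_contra hc
    rw [integral_undef hc] at h1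
    have : 0 < (1 / R) ^ a * Real.Gamma a := by positivity
    exact this.ne h1
  · filter_upwards [ae_restrict_mem measurableSet_Ioi] with u hu
    have hu' : 0 < u := hu
    positivity

/-- The singularity at `0` is not integrable. This gives the infinite predictive at samples with
vanishing residual. -/
theorem lintegral_rpow_neg_sub_one {a : ℝ} (ha : 0 < a) :
    ∫⁻ v in Set.Ioi (0 : ℝ), ENNReal.ofReal (v ^ (-a - 1)) = ⊤ := by
  have hG := Real.Gamma_pos_of_pos ha
  refine top_le_iff.1 (ENNReal.le_of_forall_nnreal_lt fun r _ => ?_)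
  have hb : 0 < (r : ℝ) + 1 := by positivity
  -- This rate `R` solves `Γ(a) R ^ (-a) = r + 1`, so the inverse-gamma integral, a lower bound,
  -- exceeds `r`.
  have hR : 0 < ((r + 1 : ℝ) / Real.Gamma a) ^ (-(1 / a)) := by positivity
  have h1 := lintegral_rpow_mul_exp_neg_div ha hR
  rw [← Real.rpow_mul (by positivity), show -(1 / a) * -a = 1 by field_simp, Real.rpow_one,
    mul_div_cancel₀ _ hG.ne'] at h1
  calc (r : ℝ≥0∞) ≤ ENNReal.ofReal (r + 1) := by
        rw [← ENNReal.ofReal_coe_nnreal]; exact ENNReal.ofReal_le_ofReal (by linarith)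
    _ ≤ _ := by
        rw [← h1]
        refine setLIntegral_mono' measurableSet_Ioi fun v hv => ENNReal.ofReal_le_ofReal ?_
        have hv' : 0 < v := hv
        exact mul_le_of_le_one_right (by positivity) (Real.exp_le_one_iff.2 (by
          rw [neg_nonpos]; positivity))

end InverseGamma

/-! ### Marginals under the baseline prior -/

section Baseline

variable {n d : ℕ} {X : Matrix (Fin n) (Fin d) ℝ}

theorem lintegral_gaussian_baselinePrior (h : Function.Injective X.mulVec) {c κ : ℝ}
    (hc : 0 < c) (hκ : 0 < κ) (y : Fin n → ℝ) :
    ∫⁻ v in Set.Ioi (0 : ℝ), ∫⁻ β : Fin d → ℝ,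
        ENNReal.ofReal ((2 * Real.pi * (κ * v)) ^ (-(n : ℝ) / 2) *
          Real.exp (-(1 / (2 * (κ * v)) * ((y - X *ᵥ β) ⬝ᵥ (y - X *ᵥ β))))) *
        baselinePrior c β v =
      ENNReal.ofReal (c * gramMass X * Real.pi ^ (-(n : ℝ) / 2) *
          (2 * κ) ^ (-(((n : ℝ) - d) / 2))) *
        ∫⁻ v in Set.Ioi (0 : ℝ), ENNReal.ofReal (v ^ (-(((n : ℝ) - d) / 2) - 1) *
          Real.exp (-(rss X y / (2 * κ) / v))) := by
  have hD := gramMass_pos h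
  rw [← lintegral_const_mul' _ _ ENNReal.ofReal_ne_top]
  refine setLIntegral_congr_fun measurableSet_Ioi fun v hv => ?_
  have hv' : 0 < v := hv
  simp only [baselinePrior]
  rw [lintegral_mul_const' _ _ ENNReal.ofReal_ne_top]
  simp_rw [ENNReal.ofReal_mul (show 0 ≤ (2 * Real.pi * (κ * v)) ^ (-(n : ℝ) / 2) by positivity)]
  rw [lintegral_const_mul' _ _ ENNReal.ofReal_ne_top,
    lintegral_exp_neg_sub_mulVec h (by positivity), ← ENNReal.ofReal_mul (by positivity),
    ← ENNReal.ofReal_mul (by positivity), ← ENNReal.ofReal_mul (by positivity)]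
  congr 1
  have he : 1 / (2 * (κ * v)) * rss X y = rss X y / (2 * κ) / v := by field_simp
  rw [he]
  have hp : (2 * Real.pi * (κ * v)) ^ (-(n : ℝ) / 2) * (1 / (2 * (κ * v))) ^ (-(d : ℝ) / 2) / v =
      Real.pi ^ (-(n : ℝ) / 2) * (2 * κ) ^ (-(((n : ℝ) - d) / 2)) *
        v ^ (-(((n : ℝ) - d) / 2) - 1) := by
    -- Both sides are positive monomials with real exponents; logarithms reduce the identity to
    -- polynomial algebra in the exponents and the logs of the bases.
    apply Real.log_injOn_pos (Set.mem_Ioi.2 (by positivity)) (Set.mem_Ioi.2 (by positivity))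
    have := Real.pi_pos
    repeat' first
      | rw [Real.log_mul (by positivity) (by positivity)]
      | rw [Real.log_div (by positivity) (by positivity)]
      | rw [Real.log_rpow (by positivity)]
    rw [Real.log_one]
    ring
  linear_combination (c * gramMass X * Real.exp (-(rss X y / (2 * κ) / v))) * hp

/-- The constant factor of the baseline marginal likelihood. -/
noncomputable def baselineConst (c : ℝ) (X : Matrix (Fin n) (Fin d) ℝ) : ℝ :=
  c * gramMass X * Real.pi ^ (-(n : ℝ) / 2) * Real.Gamma (((n : ℝ) - d) / 2)

theorem baselineConst_pos (h : Function.Injective X.mulVec) (hd : d < n) {c : ℝ} (hc : 0 < c) :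
    0 < baselineConst c X := by
  have hm : (0 : ℝ) < (n : ℝ) - d := by rw [sub_pos]; exact_mod_cast hd
  have hG : 0 < Real.Gamma (((n : ℝ) - d) / 2) := Real.Gamma_pos_of_pos (by linarith)
  have := gramMass_pos h
  unfold baselineConst; positivity

/-- The factor `(2 κ) ^ (-(n - d) / 2)` cancels against the rate `rss X y / (2 κ)`, so the result
does not depend on `κ`. -/
theorem lintegral_gaussian_baselinePrior_of_pos (h : Function.Injective X.mulVec) (hd : d < n)
    {c κ : ℝ} (hc : 0 < c) (hκ : 0 < κ) {y : Fin n → ℝ} (hy : 0 < rss X y) :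
    ∫⁻ v in Set.Ioi (0 : ℝ), ∫⁻ β : Fin d → ℝ,
        ENNReal.ofReal ((2 * Real.pi * (κ * v)) ^ (-(n : ℝ) / 2) *
          Real.exp (-(1 / (2 * (κ * v)) * ((y - X *ᵥ β) ⬝ᵥ (y - X *ᵥ β))))) *
        baselinePrior c β v =
      ENNReal.ofReal (baselineConst c X * rss X y ^ (-(((n : ℝ) - d) / 2))) := by
  have hm : (0 : ℝ) < (n : ℝ) - d := by rw [sub_pos]; exact_mod_cast hd
  have hD := gramMass_pos h
  rw [lintegral_gaussian_baselinePrior h hc hκ, lintegral_rpow_mul_exp_neg_div (by linarith)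
    (by positivity), ← ENNReal.ofReal_mul (by positivity)]
  congr 1
  rw [baselineConst, Real.div_rpow hy.le (by positivity)]
  field_simp

theorem lintegral_gaussian_baselinePrior_of_eq_zero (h : Function.Injective X.mulVec)
    (hd : d < n) {c κ : ℝ} (hc : 0 < c) (hκ : 0 < κ) {y : Fin n → ℝ} (hy : rss X y = 0) :
    ∫⁻ v in Set.Ioi (0 : ℝ), ∫⁻ β : Fin d → ℝ,
        ENNReal.ofReal ((2 * Real.pi * (κ * v)) ^ (-(n : ℝ) / 2) *
          Real.exp (-(1 / (2 * (κ * v)) * ((y - X *ᵥ β) ⬝ᵥ (y - X *ᵥ β))))) *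
        baselinePrior c β v = ⊤ := by
  have hm : (0 : ℝ) < (n : ℝ) - d := by rw [sub_pos]; exact_mod_cast hd
  have hD := gramMass_pos h
  rw [lintegral_gaussian_baselinePrior h hc hκ, hy]
  simp only [zero_div, neg_zero, Real.exp_zero, mul_one]
  rw [lintegral_rpow_neg_sub_one (by linarith), ENNReal.mul_top]
  rw [Ne, ENNReal.ofReal_eq_zero, not_le]; positivity

theorem baselinePredictive_eq (hn : 0 < n) (c : ℝ) (y : Fin n → ℝ) :
    baselinePredictive c X (n : ℝ) y = ∫⁻ v in Set.Ioi (0 : ℝ), ∫⁻ β : Fin d → ℝ,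
        ENNReal.ofReal ((2 * Real.pi * (n * v)) ^ (-(n : ℝ) / 2) *
          Real.exp (-(1 / (2 * (n * v)) * ((y - X *ᵥ β) ⬝ᵥ (y - X *ᵥ β))))) *
        baselinePrior c β v :=
  setLIntegral_congr_fun measurableSet_Ioi fun v hv => lintegral_congr fun β => by
    rw [powerLikelihood_eq hn β hv]

/-- The formula persists when the residual vanishes: the predictive is then `⊤`, its inverse is `0`,
and so is the power of `rss X y`, the exponent being positive. -/
theorem inv_baselinePredictive (h : Function.Injective X.mulVec) (hd : d < n) {c : ℝ}
    (hc : 0 < c) (y : Fin n → ℝ) :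
    (baselinePredictive c X (n : ℝ) y)⁻¹ =
      ENNReal.ofReal (rss X y ^ (((n : ℝ) - d) / 2) / baselineConst c X) := by
  have hn : 0 < n := by omega
  have hn' : (0 : ℝ) < n := by exact_mod_cast hn
  have hm : (0 : ℝ) < (n : ℝ) - d := by rw [sub_pos]; exact_mod_cast hd
  have hK := baselineConst_pos h hd hc
  rw [baselinePredictive_eq hn]
  rcases (rss_nonneg h y).eq_or_lt' with hy | hy
  · rw [lintegral_gaussian_baselinePrior_of_eq_zero h hd hc hn' hy, hy,
      Real.zero_rpow (by positivity)]
    simp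
  · rw [lintegral_gaussian_baselinePrior_of_pos h hd hc hn' hy,
      ← ENNReal.ofReal_inv_of_pos (by positivity), Real.rpow_neg hy.le, mul_inv, inv_inv,
      inv_mul_eq_div]

theorem marginalLikelihood_baselinePrior (h : Function.Injective X.mulVec) (hd : d < n) {c : ℝ}
    (hc : 0 < c) {y : Fin n → ℝ} (hy : 0 < rss X y) :
    marginalLikelihood X (baselinePrior c) y =
      ENNReal.ofReal (baselineConst c X * rss X y ^ (-(((n : ℝ) - d) / 2))) := by
  rw [← lintegral_gaussian_baselinePrior_of_pos h hd hc one_pos hy]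
  refine setLIntegral_congr_fun measurableSet_Ioi fun v hv => lintegral_congr fun β => ?_
  rw [likelihood_eq β hv, one_mul]

end Baseline

/-! ### Products of two Gaussians and Tonelli -/

theorem add_dotProduct_self_sub {k : ℕ} {s t : ℝ} (h : s + t ≠ 0) (y p q : Fin k → ℝ) :
    s * ((y - p) ⬝ᵥ (y - p)) + t * ((y - q) ⬝ᵥ (y - q)) =
      (s + t) * ((y - (s + t)⁻¹ • (s • p + t • q)) ⬝ᵥ (y - (s + t)⁻¹ • (s • p + t • q))) +
        s * t / (s + t) * ((p - q) ⬝ᵥ (p - q)) := by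
  simp only [dotProduct, Finset.mul_sum, ← Finset.sum_add_distrib]
  refine Finset.sum_congr rfl fun i _ => ?_
  simp only [Pi.sub_apply, Pi.smul_apply, Pi.add_apply, smul_eq_mul]
  field_simp
  ring

theorem dotProduct_self_sub_comm {k : ℕ} (x y : Fin k → ℝ) :
    (x - y) ⬝ᵥ (x - y) = (y - x) ⬝ᵥ (y - x) := by
  rw [← neg_sub, neg_dotProduct_neg]

section TwoGaussians

variable {n d : ℕ} {X : Matrix (Fin n) (Fin d) ℝ}

/-- Completing the square centres the product at the weighted mean of `X β` and `X γ`, which lies in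
the column space. The moment thus sees only the total precision `s + t`, and a Gaussian factor in `X
γ - X β` splits off. -/
theorem lintegral_rss_rpow_mul_exp_two (h : Function.Injective X.mulVec) (hd : d < n)
    {s t : ℝ} (hs : 0 < s) (ht : 0 < t) (β γ : Fin d → ℝ) :
    ∫⁻ z : Fin n → ℝ, ENNReal.ofReal (rss X z ^ (((n : ℝ) - d) / 2) *
        Real.exp (-(s * ((z - X *ᵥ β) ⬝ᵥ (z - X *ᵥ β)) +
          t * ((z - X *ᵥ γ) ⬝ᵥ (z - X *ᵥ γ))))) =
      ENNReal.ofReal (Real.pi ^ ((n : ℝ) / 2) * Real.Gamma ((n : ℝ) - d) /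
        Real.Gamma (((n : ℝ) - d) / 2) * (s + t) ^ (-(n : ℝ) / 2 - ((n : ℝ) - d) / 2) *
        Real.exp (-(s * t / (s + t) * ((X *ᵥ γ - X *ᵥ β) ⬝ᵥ (X *ᵥ γ - X *ᵥ β))))) := by
  have hst : 0 < s + t := add_pos hs ht
  have hm : (0 : ℝ) < (n : ℝ) - d := by rw [sub_pos]; exact_mod_cast hd
  have hG : 0 < Real.Gamma (((n : ℝ) - d) / 2) := Real.Gamma_pos_of_pos (by linarith)
  have hG2 : 0 < Real.Gamma ((n : ℝ) - d) := Real.Gamma_pos_of_pos hm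
  have h1 : (s + t)⁻¹ • (s • X *ᵥ β + t • X *ᵥ γ) =
      X *ᵥ ((s + t)⁻¹ • (s • β + t • γ)) := by
    simp only [Matrix.mulVec_smul, Matrix.mulVec_add]
  simp_rw [add_dotProduct_self_sub hst.ne', neg_add, Real.exp_add, ← mul_assoc]
  simp_rw [ENNReal.ofReal_mul' (Real.exp_pos (-(s * t / (s + t) * _))).le]
  rw [lintegral_mul_const' _ _ ENNReal.ofReal_ne_top, h1,
    lintegral_rss_rpow_mul_exp_sub_mulVec h hd hst, dotProduct_self_sub_comm (X *ᵥ β)]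

/-- The weighted mean of `y` and `X γ` acts as the response. Its residual is `p / (p + r)` times
that of `y`, since `X γ` contributes none. -/
theorem lintegral_exp_neg_sub_mulVec_two (h : Function.Injective X.mulVec)
    {p r : ℝ} (hp : 0 < p) (hr : 0 < r) (y : Fin n → ℝ) (γ : Fin d → ℝ) :
    ∫⁻ β : Fin d → ℝ, ENNReal.ofReal (Real.exp (-(p * ((y - X *ᵥ β) ⬝ᵥ (y - X *ᵥ β)) +
          r * ((X *ᵥ γ - X *ᵥ β) ⬝ᵥ (X *ᵥ γ - X *ᵥ β))))) =
      ENNReal.ofReal (gramMass X * (p + r) ^ (-(d : ℝ) / 2) *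
        Real.exp (-(p ^ 2 / (p + r) * rss X y)) *
        Real.exp (-(p * r / (p + r) * ((y - X *ᵥ γ) ⬝ᵥ (y - X *ᵥ γ))))) := by
  have hpr : 0 < p + r := add_pos hp hr
  have h1 : rss X ((p + r)⁻¹ • (p • y + r • X *ᵥ γ)) = (p / (p + r)) ^ 2 * rss X y := by
    rw [rss_smul, ← Matrix.mulVec_smul, rss_add_mulVec h, rss_smul]
    field_simp
  have h2 : ∀ β : Fin d → ℝ, p * ((y - X *ᵥ β) ⬝ᵥ (y - X *ᵥ β)) +
      r * ((X *ᵥ γ - X *ᵥ β) ⬝ᵥ (X *ᵥ γ - X *ᵥ β)) =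
      (p + r) * (((p + r)⁻¹ • (p • y + r • X *ᵥ γ) - X *ᵥ β) ⬝ᵥ
        ((p + r)⁻¹ • (p • y + r • X *ᵥ γ) - X *ᵥ β)) +
        p * r / (p + r) * ((y - X *ᵥ γ) ⬝ᵥ (y - X *ᵥ γ)) := fun β => by
    rw [dotProduct_self_sub_comm y, dotProduct_self_sub_comm (X *ᵥ γ),
      add_dotProduct_self_sub hpr.ne', dotProduct_self_sub_comm (X *ᵥ β)]
  simp_rw [h2, neg_add, Real.exp_add]
  simp_rw [ENNReal.ofReal_mul' (Real.exp_pos (-(p * r / (p + r) * _))).le]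
  rw [lintegral_mul_const' _ _ ENNReal.ofReal_ne_top, lintegral_exp_neg_sub_mulVec h hpr, h1]
  congr 5
  field_simp

end TwoGaussians

/-- Used to bring the integrals over `β` and `z` inside those over `w` and `γ`. -/
theorem lintegral_four_swap {α β γ δ : Type*} [MeasurableSpace α] [MeasurableSpace β]
    [MeasurableSpace γ] [MeasurableSpace δ] {μ : Measure α} {ν : Measure β} {ρ : Measure γ}
    {σ : Measure δ} [SFinite μ] [SFinite ν] [SFinite ρ] [SFinite σ]
    {f : α → β → γ → δ → ℝ≥0∞}
    (hf : Measurable fun p : α × β × γ × δ => f p.1 p.2.1 p.2.2.1 p.2.2.2) :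
    ∫⁻ a, ∫⁻ b, ∫⁻ c, ∫⁻ d, f a b c d ∂σ ∂ρ ∂ν ∂μ =
      ∫⁻ c, ∫⁻ d, ∫⁻ a, ∫⁻ b, f a b c d ∂ν ∂μ ∂σ ∂ρ := by
  have h1 : ∀ a, ∫⁻ b, ∫⁻ c, ∫⁻ d, f a b c d ∂σ ∂ρ ∂ν =
      ∫⁻ c, ∫⁻ d, ∫⁻ b, f a b c d ∂ν ∂σ ∂ρ := fun a => by
    rw [lintegral_lintegral_swap]
    · refine lintegral_congr fun c => ?_
      rw [lintegral_lintegral_swap]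
      exact (hf.comp (f := fun q : β × δ => (a, q.1, c, q.2)) (by fun_prop)).aemeasurable
    · exact (Measurable.lintegral_prod_right' (f := fun q : (β × γ) × δ => f a q.1.1 q.1.2 q.2)
        (hf.comp (f := fun q : (β × γ) × δ => (a, q.1.1, q.1.2, q.2))
          (by fun_prop))).aemeasurable
  simp_rw [h1]
  have h2 : Measurable fun q : (α × γ) × δ => ∫⁻ b, f q.1.1 b q.1.2 q.2 ∂ν :=
    Measurable.lintegral_prod_right'
      (f := fun q : ((α × γ) × δ) × β => f q.1.1.1 q.2 q.1.1.2 q.1.2)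
      (hf.comp (f := fun q : ((α × γ) × δ) × β => (q.1.1.1, q.2, q.1.1.2, q.1.2)) (by fun_prop))
  rw [lintegral_lintegral_swap]
  · refine lintegral_congr fun c => ?_
    rw [lintegral_lintegral_swap]
    exact (h2.comp (f := fun q : α × δ => ((q.1, c), q.2)) (by fun_prop)).aemeasurable
  · exact (Measurable.lintegral_prod_right' h2).aemeasurable

/-! ### The numerator as an integral over two variances -/

section Numerator

variable {n d d0 : ℕ} {X : Matrix (Fin n) (Fin d) ℝ} {X0 : Matrix (Fin n) (Fin d0) ℝ}

/-- The joint density of data, imaginary data and parameters of both models. -/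
noncomputable def jointDensity (c c0 : ℝ) (X : Matrix (Fin n) (Fin d) ℝ)
    (X0 : Matrix (Fin n) (Fin d0) ℝ) (y : Fin n → ℝ) (v : ℝ) (β : Fin d → ℝ) (z : Fin n → ℝ)
    (w : ℝ) (γ : Fin d0 → ℝ) : ℝ :=
  (c / v * (c0 / w) * (2 * Real.pi * v) ^ (-(n : ℝ) / 2) *
    (2 * Real.pi * (n * v)) ^ (-(n : ℝ) / 2) * (2 * Real.pi * (n * w)) ^ (-(n : ℝ) / 2) /
    baselineConst c X) *
  Real.exp (-(1 / (2 * v) * ((y - X *ᵥ β) ⬝ᵥ (y - X *ᵥ β)))) *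
  (rss X z ^ (((n : ℝ) - d) / 2) *
    Real.exp (-(1 / (2 * (n * v)) * ((z - X *ᵥ β) ⬝ᵥ (z - X *ᵥ β)) +
      1 / (2 * (n * w)) * ((z - X0 *ᵥ γ) ⬝ᵥ (z - X0 *ᵥ γ)))))

theorem measurable_jointDensity (c c0 : ℝ) (y : Fin n → ℝ) (v : ℝ) :
    Measurable fun p : (Fin d → ℝ) × (Fin n → ℝ) × ℝ × (Fin d0 → ℝ) =>
      jointDensity c c0 X X0 y v p.1 p.2.1 p.2.2.1 p.2.2.2 := by
  have e1 : Measurable fun p : (Fin d → ℝ) × (Fin n → ℝ) × ℝ × (Fin d0 → ℝ) =>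
      (y - X *ᵥ p.1) ⬝ᵥ (y - X *ᵥ p.1) := by
    refine Continuous.measurable (Continuous.dotProduct ?_ ?_) <;>
    exact continuous_const.sub (continuous_const.matrix_mulVec continuous_fst)
  have e2 : Measurable fun p : (Fin d → ℝ) × (Fin n → ℝ) × ℝ × (Fin d0 → ℝ) =>
      (p.2.1 - X *ᵥ p.1) ⬝ᵥ (p.2.1 - X *ᵥ p.1) := by
    refine Continuous.measurable (Continuous.dotProduct ?_ ?_) <;>
    exact (by fun_prop : Continuous fun p : (Fin d → ℝ) × (Fin n → ℝ) × ℝ × (Fin d0 → ℝ) =>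
      p.2.1).sub (continuous_const.matrix_mulVec continuous_fst)
  have e3 : Measurable fun p : (Fin d → ℝ) × (Fin n → ℝ) × ℝ × (Fin d0 → ℝ) =>
      (p.2.1 - X0 *ᵥ p.2.2.2) ⬝ᵥ (p.2.1 - X0 *ᵥ p.2.2.2) := by
    refine Continuous.measurable (Continuous.dotProduct ?_ ?_) <;>
    exact (by fun_prop : Continuous fun p : (Fin d → ℝ) × (Fin n → ℝ) × ℝ × (Fin d0 → ℝ) =>
      p.2.1).sub (continuous_const.matrix_mulVec (by fun_prop))
  have e4 : Measurable fun p : (Fin d → ℝ) × (Fin n → ℝ) × ℝ × (Fin d0 → ℝ) => rss X p.2.1 :=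
    continuous_rss.measurable.comp (by fun_prop)
  unfold jointDensity
  fun_prop

theorem likelihood_mul_jpepPrior (h : Function.Injective X.mulVec) (hd : d < n) {c c0 : ℝ}
    (hc : 0 < c) (y : Fin n → ℝ) {v : ℝ} (hv : 0 < v) (β : Fin d → ℝ) :
    likelihood X β v y * jpepPrior c c0 X X0 (n : ℝ) β v =
      ∫⁻ z : Fin n → ℝ, ∫⁻ w in Set.Ioi (0 : ℝ), ∫⁻ γ : Fin d0 → ℝ,
        ENNReal.ofReal (jointDensity c c0 X X0 y v β z w γ) := by
  have hn : 0 < n := by omega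
  have hn' : (0 : ℝ) < n := by exact_mod_cast hn
  have hK := baselineConst_pos h hd hc
  rw [likelihood_eq β hv, jpepPrior, baselinePrior, ← mul_assoc,
    ← ENNReal.ofReal_mul (by positivity), ← lintegral_const_mul' _ _ ENNReal.ofReal_ne_top]
  refine lintegral_congr fun z => ?_
  have hz := rss_nonneg h z
  -- `P` stands for the reference predictive, which may be `⊤`, so it stays in `ℝ≥0∞`.
  have hcomb : ∀ (P : ℝ≥0∞) {a b r : ℝ}, 0 ≤ a → 0 ≤ b →
      ENNReal.ofReal a * (P * ENNReal.ofReal b * ENNReal.ofReal r) =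
        ENNReal.ofReal (a * (b * r)) * P := fun P a b r ha hb => by
    rw [ENNReal.ofReal_mul ha, ENNReal.ofReal_mul hb]; ring
  rw [div_eq_mul_inv (baselinePredictive _ _ _ _), inv_baselinePredictive h hd hc,
    powerLikelihood_eq hn β hv, hcomb _ (by positivity) (by positivity), baselinePredictive_eq hn,
    ← lintegral_const_mul' _ _ ENNReal.ofReal_ne_top]
  refine setLIntegral_congr_fun measurableSet_Ioi fun w hw => ?_
  have hw' : 0 < w := hw
  simp only [baselinePrior]
  rw [← lintegral_const_mul' _ _ ENNReal.ofReal_ne_top]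
  refine lintegral_congr fun γ => ?_
  rw [← ENNReal.ofReal_mul (by positivity), ← ENNReal.ofReal_mul (by positivity), jointDensity,
    neg_add, Real.exp_add]
  congr 1
  ring

/-- The marginal likelihood of the J-PEP model as an integral over the two variances. -/
theorem marginalLikelihood_jpepPrior (e : Fin d0 ↪ Fin d) (h : Function.Injective X.mulVec)
    (hd : d < n) {c c0 : ℝ} (hc : 0 < c) (hc0 : 0 < c0) (y : Fin n → ℝ) :
    marginalLikelihood X (jpepPrior c c0 X (X.submatrix id e) (n : ℝ)) y =
      ∫⁻ v in Set.Ioi (0 : ℝ), ∫⁻ w in Set.Ioi (0 : ℝ),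
        ENNReal.ofReal ((c / v * (c0 / w) * (2 * Real.pi * v) ^ (-(n : ℝ) / 2) *
          (2 * Real.pi * (n * v)) ^ (-(n : ℝ) / 2) * (2 * Real.pi * (n * w)) ^ (-(n : ℝ) / 2) /
          baselineConst c X) *
          (Real.pi ^ ((n : ℝ) / 2) * Real.Gamma ((n : ℝ) - d) /
            Real.Gamma (((n : ℝ) - d) / 2) *
            ((v + w) / (2 * n * v * w)) ^ (-(n : ℝ) / 2 - ((n : ℝ) - d) / 2)) *
          (gramMass X * ((v + n * (v + w)) / (2 * n * v * (v + w))) ^ (-(d : ℝ) / 2) *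
            Real.exp (-(n * (v + w) / (2 * v * (v + n * (v + w))) * rss X y))) *
          (gramMass (X.submatrix id e) * (1 / (2 * (v + n * (v + w)))) ^ (-(d0 : ℝ) / 2) *
            Real.exp (-(1 / (2 * (v + n * (v + w))) * rss (X.submatrix id e) y)))) := by
  have hn' : (0 : ℝ) < n := by exact_mod_cast (show 0 < n by omega)
  have hm : (0 : ℝ) < (n : ℝ) - d := by rw [sub_pos]; exact_mod_cast hd
  have hG : 0 < Real.Gamma (((n : ℝ) - d) / 2) := Real.Gamma_pos_of_pos (by linarith)
  have hG2 : 0 < Real.Gamma ((n : ℝ) - d) := Real.Gamma_pos_of_pos hm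
  have hK := baselineConst_pos h hd hc
  have hD := gramMass_pos h
  refine setLIntegral_congr_fun measurableSet_Ioi fun v hv => ?_
  have hv' : 0 < v := hv
  simp_rw [likelihood_mul_jpepPrior h hd hc y hv']
  rw [lintegral_four_swap (measurable_jointDensity c c0 y v).ennreal_ofReal]
  refine setLIntegral_congr_fun measurableSet_Ioi fun w hw => ?_
  have hw' : 0 < w := hw
  simp only [jointDensity]
  set k := c / v * (c0 / w) * (2 * Real.pi * v) ^ (-(n : ℝ) / 2) *
    (2 * Real.pi * (n * v)) ^ (-(n : ℝ) / 2) * (2 * Real.pi * (n * w)) ^ (-(n : ℝ) / 2) /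
    baselineConst c X with hk
  have hk0 : 0 < k := by positivity
  -- Variances add as Gaussians are convolved: eliminating `z` gives variance `n (v + w)` between `X
  -- β` and the reference mean, and eliminating `β` gives `v + n (v + w)` between `y` and that mean.
  have hst : 1 / (2 * (n * v)) + 1 / (2 * (n * w)) = (v + w) / (2 * n * v * w) := by
    field_simp; ring
  have hr : 1 / (2 * (n * v)) * (1 / (2 * (n * w))) / ((v + w) / (2 * n * v * w)) =
      1 / (2 * n * (v + w)) := by
    field_simp
  have hpr : 1 / (2 * v) + 1 / (2 * n * (v + w)) =
      (v + n * (v + w)) / (2 * n * v * (v + w)) := by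
    field_simp; ring
  have hrho : 1 / (2 * v) * (1 / (2 * n * (v + w))) /
      ((v + n * (v + w)) / (2 * n * v * (v + w))) = 1 / (2 * (v + n * (v + w))) := by
    field_simp
  have hp2 : (1 / (2 * v)) ^ 2 / ((v + n * (v + w)) / (2 * n * v * (v + w))) =
      n * (v + w) / (2 * v * (v + n * (v + w))) := by
    field_simp
  set C := Real.pi ^ ((n : ℝ) / 2) * Real.Gamma ((n : ℝ) - d) / Real.Gamma (((n : ℝ) - d) / 2) *
    ((v + w) / (2 * n * v * w)) ^ (-(n : ℝ) / 2 - ((n : ℝ) - d) / 2) with hC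
  have hC0 : 0 < C := by positivity
  have step : ∀ γ : Fin d0 → ℝ, ∫⁻ β : Fin d → ℝ, ∫⁻ z : Fin n → ℝ, ENNReal.ofReal
      (k * Real.exp (-(1 / (2 * v) * ((y - X *ᵥ β) ⬝ᵥ (y - X *ᵥ β)))) *
        (rss X z ^ (((n : ℝ) - d) / 2) *
          Real.exp (-(1 / (2 * (n * v)) * ((z - X *ᵥ β) ⬝ᵥ (z - X *ᵥ β)) +
            1 / (2 * (n * w)) * ((z - X.submatrix id e *ᵥ γ) ⬝ᵥ
              (z - X.submatrix id e *ᵥ γ)))))) =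
      ENNReal.ofReal (k * C * (gramMass X *
        ((v + n * (v + w)) / (2 * n * v * (v + w))) ^ (-(d : ℝ) / 2) *
          Real.exp (-(n * (v + w) / (2 * v * (v + n * (v + w))) * rss X y)))) *
      ENNReal.ofReal (Real.exp (-(1 / (2 * (v + n * (v + w))) *
        ((y - X.submatrix id e *ᵥ γ) ⬝ᵥ (y - X.submatrix id e *ᵥ γ))))) := fun γ => by
    rw [mulVec_submatrix_apply_extend]
    have inner : ∀ β : Fin d → ℝ, ∫⁻ z : Fin n → ℝ, ENNReal.ofReal
        (k * Real.exp (-(1 / (2 * v) * ((y - X *ᵥ β) ⬝ᵥ (y - X *ᵥ β)))) *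
          (rss X z ^ (((n : ℝ) - d) / 2) *
            Real.exp (-(1 / (2 * (n * v)) * ((z - X *ᵥ β) ⬝ᵥ (z - X *ᵥ β)) +
              1 / (2 * (n * w)) * ((z - X *ᵥ Function.extend e γ 0) ⬝ᵥ
                (z - X *ᵥ Function.extend e γ 0)))))) =
        ENNReal.ofReal (k * C) * ENNReal.ofReal
          (Real.exp (-(1 / (2 * v) * ((y - X *ᵥ β) ⬝ᵥ (y - X *ᵥ β)) +
            1 / (2 * n * (v + w)) * ((X *ᵥ Function.extend e γ 0 - X *ᵥ β) ⬝ᵥ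
              (X *ᵥ Function.extend e γ 0 - X *ᵥ β))))) := fun β => by
      simp_rw [ENNReal.ofReal_mul (show 0 ≤ k * Real.exp (-(1 / (2 * v) *
        ((y - X *ᵥ β) ⬝ᵥ (y - X *ᵥ β)))) by positivity)]
      rw [lintegral_const_mul' _ _ ENNReal.ofReal_ne_top,
        lintegral_rss_rpow_mul_exp_two h hd (by positivity) (by positivity), hst, hr, ← hC,
        ← ENNReal.ofReal_mul (by positivity), ← ENNReal.ofReal_mul (by positivity), neg_add,
        Real.exp_add]
      congr 1
      ring
    simp_rw [inner]
    rw [lintegral_const_mul' _ _ ENNReal.ofReal_ne_top,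
      lintegral_exp_neg_sub_mulVec_two h (by positivity) (by positivity), hpr, hrho, hp2,
      ← ENNReal.ofReal_mul (by positivity), ← ENNReal.ofReal_mul (by positivity)]
    congr 1
    ring
  simp_rw [step]
  rw [lintegral_const_mul' _ _ ENNReal.ofReal_ne_top,
    lintegral_exp_neg_sub_mulVec (mulVec_submatrix_injective e h) (by positivity),
    ← ENNReal.ofReal_mul (by positivity)]

end Numerator

/-! ### The angular substitution -/

theorem lintegral_Ioi_eq_lintegral_cot_sq {v : ℝ} (hv : 0 < v) (g : ℝ → ℝ≥0∞) :
    ∫⁻ w in Set.Ioi (0 : ℝ), g w = ∫⁻ φ in Set.Ioo (0 : ℝ) (Real.pi / 2),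
      ENNReal.ofReal (2 * v * Real.cos φ / Real.sin φ ^ 3) *
        g (v * (Real.cos φ / Real.sin φ) ^ 2) := by
  have hs : ∀ φ ∈ Set.Ioo (0 : ℝ) (Real.pi / 2), 0 < Real.sin φ := fun φ hφ =>
    Real.sin_pos_of_pos_of_lt_pi hφ.1 (by linarith [hφ.2, Real.pi_pos])
  have hc : ∀ φ ∈ Set.Ioo (0 : ℝ) (Real.pi / 2), 0 < Real.cos φ := fun φ hφ =>
    Real.cos_pos_of_mem_Ioo ⟨by linarith [hφ.1, Real.pi_pos], hφ.2⟩
  have hcot : ∀ φ, Real.cos φ / Real.sin φ = Real.tan (Real.pi / 2 - φ) := fun φ => by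
    rw [Real.tan_pi_div_two_sub, Real.tan_eq_sin_div_cos, inv_div]
  have himg : (fun φ : ℝ => v * (Real.cos φ / Real.sin φ) ^ 2) '' Set.Ioo 0 (Real.pi / 2) =
      Set.Ioi 0 := by
    ext x
    simp only [Set.mem_image, Set.mem_Ioi]
    constructor
    · rintro ⟨φ, hφ, rfl⟩
      have := hs φ hφ; have := hc φ hφ
      positivity
    · intro hx
      have hpos : 0 < √(x / v) := Real.sqrt_pos.2 (by positivity)
      refine ⟨Real.pi / 2 - Real.arctan √(x / v), ⟨?_, ?_⟩, ?_⟩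
      · linarith [Real.arctan_lt_pi_div_two √(x / v)]
      · linarith [Real.arctan_pos.2 hpos]
      · rw [hcot, sub_sub_cancel, Real.tan_arctan, Real.sq_sqrt (by positivity)]
        field_simp
  have hinj : Set.InjOn (fun φ : ℝ => v * (Real.cos φ / Real.sin φ) ^ 2)
      (Set.Ioo 0 (Real.pi / 2)) := by
    intro φ hφ ψ hψ hE
    have h1 : (Real.cos φ / Real.sin φ) ^ 2 = (Real.cos ψ / Real.sin ψ) ^ 2 :=
      mul_left_cancel₀ hv.ne' hE
    have h2 : Real.cos φ / Real.sin φ = Real.cos ψ / Real.sin ψ :=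
      (pow_left_inj₀ (div_pos (hc φ hφ) (hs φ hφ)).le (div_pos (hc ψ hψ) (hs ψ hψ)).le
        two_ne_zero).1 h1
    rw [hcot, hcot] at h2
    have := Real.injOn_tan ⟨by linarith [hφ.2, Real.pi_pos], by linarith [hφ.1]⟩
      ⟨by linarith [hψ.2, Real.pi_pos], by linarith [hψ.1]⟩ h2
    linarith
  have hderiv : ∀ φ ∈ Set.Ioo (0 : ℝ) (Real.pi / 2),
      HasDerivWithinAt (fun φ : ℝ => v * (Real.cos φ / Real.sin φ) ^ 2)
        (-(2 * v * Real.cos φ / Real.sin φ ^ 3)) (Set.Ioo 0 (Real.pi / 2)) φ := by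
    intro φ hφ
    have h0 := (hs φ hφ).ne'
    have h1 := (((Real.hasDerivAt_cos φ).div (Real.hasDerivAt_sin φ) h0).pow 2).const_mul v
    refine (h1.congr_deriv ?_).hasDerivWithinAt
    have h2 : -Real.sin φ * Real.sin φ - Real.cos φ * Real.cos φ = -1 := by
      linear_combination -Real.sin_sq_add_cos_sq φ
    rw [h2, Pi.div_apply, pow_one, Nat.cast_two]
    field_simp
  have h := lintegral_image_eq_lintegral_abs_deriv_mul measurableSet_Ioo hderiv hinj g
  rw [himg] at h
  rw [h]
  refine setLIntegral_congr_fun measurableSet_Ioo fun φ hφ => ?_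
  have := hs φ hφ; have := hc φ hφ
  rw [abs_neg, abs_of_pos (by positivity)]

/-- The integrand of the double integral over the variances, in the coordinates `(v, φ)` with
`w = v cot² φ`. -/
theorem varianceIntegrand_cot_sq {n d d0 v S K R R0 A D D0 c c0 G Gh : ℝ}
    (hn : 0 < n) (hv : 0 < v) (hS : 0 < S) (hK : 0 < K) (hSK : S ^ 2 + K ^ 2 = 1) :
    2 * v * K / S ^ 3 * ((c / v * (c0 / (v * (K / S) ^ 2)) * (2 * Real.pi * v) ^ (-n / 2) *
          (2 * Real.pi * (n * v)) ^ (-n / 2) *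
          (2 * Real.pi * (n * (v * (K / S) ^ 2))) ^ (-n / 2) / A) *
          (Real.pi ^ (n / 2) * G / Gh *
            ((v + v * (K / S) ^ 2) / (2 * n * v * (v * (K / S) ^ 2))) ^ (-n / 2 - (n - d) / 2)) *
          (D * ((v + n * (v + v * (K / S) ^ 2)) /
            (2 * n * v * (v + v * (K / S) ^ 2))) ^ (-d / 2) *
            Real.exp (-(n * (v + v * (K / S) ^ 2) /
              (2 * v * (v + n * (v + v * (K / S) ^ 2))) * R))) *
          (D0 * (1 / (2 * (v + n * (v + v * (K / S) ^ 2)))) ^ (-d0 / 2) *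
            Real.exp (-(1 / (2 * (v + n * (v + v * (K / S) ^ 2))) * R0)))) =
      (2 * c * c0 * D * D0 * G / (A * Gh) * Real.pi ^ (-n) * 2 ^ (-((n - d0) / 2)) *
        S ^ (n - d0 - 1) * K ^ (n - d - 1) * (n + S ^ 2) ^ ((d0 - d) / 2)) *
      (v ^ (-((n - d0) / 2) - 1) *
        Real.exp (-((n * R + S ^ 2 * R0) / (2 * (n + S ^ 2)) / v))) := by
  -- With `S = sin φ` and `K = cos φ`, the variance ratios become functions of `φ` alone, and `v`
  -- separates as a power.
  have hw : v + v * (K / S) ^ 2 = v / S ^ 2 := by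
    field_simp; linear_combination hSK
  have e1 : v / S ^ 2 / (2 * n * v * (v * (K / S) ^ 2)) = 1 / (2 * n * v * K ^ 2) := by
    field_simp
  have e2 : v + n * (v / S ^ 2) = v * (n + S ^ 2) / S ^ 2 := by field_simp; ring
  have e3 : v * (n + S ^ 2) / S ^ 2 / (2 * n * v * (v / S ^ 2)) = (n + S ^ 2) / (2 * n * v) := by
    field_simp
  have e4 : 1 / (2 * (v * (n + S ^ 2) / S ^ 2)) = S ^ 2 / (2 * v * (n + S ^ 2)) := by field_simp
  have e5 : n * (v / S ^ 2) / (2 * v * (v * (n + S ^ 2) / S ^ 2)) =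
      n / (2 * v * (n + S ^ 2)) := by field_simp
  rw [hw, e1, e2, e3, e4, e5]
  have hexp : Real.exp (-((n * R + S ^ 2 * R0) / (2 * (n + S ^ 2)) / v)) =
      Real.exp (-(n / (2 * v * (n + S ^ 2)) * R)) *
        Real.exp (-(S ^ 2 / (2 * v * (n + S ^ 2)) * R0)) := by
    rw [← Real.exp_add]; congr 1; field_simp; ring
  rw [hexp]
  generalize Real.exp (-(n / (2 * v * (n + S ^ 2)) * R)) = E1
  generalize Real.exp (-(S ^ 2 / (2 * v * (n + S ^ 2)) * R0)) = E2
  have hpi := Real.pi_pos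
  have key : 2 * v * K / S ^ 3 * (1 / v * (1 / (v * (K / S) ^ 2)) * (2 * Real.pi * v) ^ (-n / 2) *
          (2 * Real.pi * (n * v)) ^ (-n / 2) *
          (2 * Real.pi * (n * (v * (K / S) ^ 2))) ^ (-n / 2)) *
          Real.pi ^ (n / 2) * (1 / (2 * n * v * K ^ 2)) ^ (-n / 2 - (n - d) / 2) *
          ((n + S ^ 2) / (2 * n * v)) ^ (-d / 2) *
          (S ^ 2 / (2 * v * (n + S ^ 2))) ^ (-d0 / 2) =
      2 * Real.pi ^ (-n) * 2 ^ (-((n - d0) / 2)) * S ^ (n - d0 - 1) * K ^ (n - d - 1) *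
        (n + S ^ 2) ^ ((d0 - d) / 2) * v ^ (-((n - d0) / 2) - 1) := by
    apply Real.log_injOn_pos (Set.mem_Ioi.2 (by positivity)) (Set.mem_Ioi.2 (by positivity))
    repeat' first
      | rw [Real.log_mul (by positivity) (by positivity)]
      | rw [Real.log_div (by positivity) (by positivity)]
      | rw [Real.log_rpow (by positivity)]
      | rw [Real.log_pow]
    simp only [Real.log_one]
    push_cast
    ring
  linear_combination (c * c0 * D * D0 * G / (A * Gh) * E1 * E2) * key

/-- Here `c` and `D`, the prior constant and `gramMass` of the larger model, cancel. What remains is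
the reference marginal times the closed form; the second `Gh` comes from `baselineConst`. -/
theorem bfIntegrand_const {n d d0 S K R R0 D D0 c c0 G Gh G0 : ℝ}
    (hn : 0 < n) (hS : 0 < S) (hR : 0 ≤ R) (hR0 : 0 < R0)
    (hD : 0 < D) (hc : 0 < c) (hGh : 0 < Gh) :
    (2 * c * c0 * D * D0 * G / (c * D * Real.pi ^ (-n / 2) * Gh * Gh) * Real.pi ^ (-n) *
        2 ^ (-((n - d0) / 2)) * S ^ (n - d0 - 1) * K ^ (n - d - 1) *
        (n + S ^ 2) ^ ((d0 - d) / 2)) *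
      (G0 * ((n * R + S ^ 2 * R0) / (2 * (n + S ^ 2))) ^ (-((n - d0) / 2))) =
    c0 * D0 * Real.pi ^ (-n / 2) * G0 * R0 ^ (-((n - d0) / 2)) *
      (2 * G / Gh ^ 2 * (S ^ (n - d0 - 1) * K ^ (n - d - 1) * (n + S ^ 2) ^ ((n - d) / 2) /
        (n * (R / R0) + S ^ 2) ^ ((n - d0) / 2))) := by
  have hpi := Real.pi_pos
  have e : n * (R / R0) + S ^ 2 = (n * R + S ^ 2 * R0) / R0 := by field_simp
  have hpos : 0 < n * R + S ^ 2 * R0 := by positivity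
  rw [e]
  have key : 1 / Real.pi ^ (-n / 2) * Real.pi ^ (-n) * 2 ^ (-((n - d0) / 2)) *
      (n + S ^ 2) ^ ((d0 - d) / 2) *
        ((n * R + S ^ 2 * R0) / (2 * (n + S ^ 2))) ^ (-((n - d0) / 2)) =
      Real.pi ^ (-n / 2) * R0 ^ (-((n - d0) / 2)) * ((n + S ^ 2) ^ ((n - d) / 2) /
        ((n * R + S ^ 2 * R0) / R0) ^ ((n - d0) / 2)) := by
    apply Real.log_injOn_pos (Set.mem_Ioi.2 (by positivity)) (Set.mem_Ioi.2 (by positivity))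
    repeat' first
      | rw [Real.log_mul (by positivity) (by positivity)]
      | rw [Real.log_div (by positivity) (by positivity)]
      | rw [Real.log_rpow (by positivity)]
    simp only [Real.log_one]
    ring
  have hcanc : 2 * c * c0 * D * D0 * G / (c * D * Real.pi ^ (-n / 2) * Gh * Gh) =
      2 * c0 * D0 * G / Gh ^ 2 * (1 / Real.pi ^ (-n / 2)) := by
    have : 0 < Real.pi ^ (-n / 2) := by positivity
    field_simp
  rw [hcanc]
  linear_combination (2 * c0 * D0 * G / Gh ^ 2 * S ^ (n - d0 - 1) * K ^ (n - d - 1) * G0) * key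

/-! ### The closed form and its finiteness -/

section BayesFactor

variable {n d d0 : ℕ} {X : Matrix (Fin n) (Fin d) ℝ}

theorem marginalLikelihood_jpepPrior_eq (e : Fin d0 ↪ Fin d) (h : Function.Injective X.mulVec)
    (hd : d < n) {c c0 : ℝ} (hc : 0 < c) (hc0 : 0 < c0) (y : Fin n → ℝ)
    (hy : 0 < rss (X.submatrix id e) y) :
    marginalLikelihood X (jpepPrior c c0 X (X.submatrix id e) (n : ℝ)) y =
      ENNReal.ofReal (baselineConst c0 (X.submatrix id e) *
          rss (X.submatrix id e) y ^ (-(((n : ℝ) - d0) / 2))) *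
        (ENNReal.ofReal (2 * Real.Gamma ((n : ℝ) - d) / Real.Gamma (((n : ℝ) - d) / 2) ^ 2) *
          ∫⁻ φ in Set.Ioo (0 : ℝ) (Real.pi / 2),
            ENNReal.ofReal (bfIntegrand n d d0 (rss X y) (rss (X.submatrix id e) y) φ)) := by
  have hd0 : d0 ≤ d := by simpa using Fintype.card_le_of_embedding e
  have hn' : (0 : ℝ) < n := by exact_mod_cast (show 0 < n by omega)
  have hm : (0 : ℝ) < (n : ℝ) - d := by rw [sub_pos]; exact_mod_cast hd
  have hm0 : (0 : ℝ) < (n : ℝ) - d0 := by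
    rw [sub_pos]; exact_mod_cast (show d0 < n by omega)
  have hG : 0 < Real.Gamma (((n : ℝ) - d) / 2) := Real.Gamma_pos_of_pos (by linarith)
  have hG2 : 0 < Real.Gamma ((n : ℝ) - d) := Real.Gamma_pos_of_pos hm
  have hD := gramMass_pos h
  have hD0 := gramMass_pos (mulVec_submatrix_injective e h)
  have hA := baselineConst_pos h hd hc
  have hB := baselineConst_pos (mulVec_submatrix_injective e h)
    (show d0 < n by omega) hc0
  have hR := rss_nonneg h y
  have hs : ∀ φ ∈ Set.Ioo (0 : ℝ) (Real.pi / 2), 0 < Real.sin φ := fun φ hφ =>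
    Real.sin_pos_of_pos_of_lt_pi hφ.1 (by linarith [hφ.2, Real.pi_pos])
  have hcos : ∀ φ ∈ Set.Ioo (0 : ℝ) (Real.pi / 2), 0 < Real.cos φ := fun φ hφ =>
    Real.cos_pos_of_mem_Ioo ⟨by linarith [hφ.1, Real.pi_pos], hφ.2⟩
  rw [marginalLikelihood_jpepPrior e h hd hc hc0]
  set R := rss X y
  set R0 := rss (X.submatrix id e) y
  set k : ℝ → ℝ := fun φ => 2 * c * c0 * gramMass X * gramMass (X.submatrix id e) *
    Real.Gamma ((n : ℝ) - d) / (baselineConst c X * Real.Gamma (((n : ℝ) - d) / 2)) *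
    Real.pi ^ (-(n : ℝ)) * 2 ^ (-(((n : ℝ) - d0) / 2)) * Real.sin φ ^ ((n : ℝ) - d0 - 1) *
    Real.cos φ ^ ((n : ℝ) - d - 1) * (n + Real.sin φ ^ 2) ^ (((d0 : ℝ) - d) / 2) with hk
  have hk0 : ∀ φ ∈ Set.Ioo (0 : ℝ) (Real.pi / 2), 0 ≤ k φ := fun φ hφ => by
    have := hs φ hφ
    have := hcos φ hφ
    positivity
  have step1 : ∀ v ∈ Set.Ioi (0 : ℝ), ∫⁻ w in Set.Ioi (0 : ℝ),
        ENNReal.ofReal ((c / v * (c0 / w) * (2 * Real.pi * v) ^ (-(n : ℝ) / 2) *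
          (2 * Real.pi * (n * v)) ^ (-(n : ℝ) / 2) * (2 * Real.pi * (n * w)) ^ (-(n : ℝ) / 2) /
          baselineConst c X) *
          (Real.pi ^ ((n : ℝ) / 2) * Real.Gamma ((n : ℝ) - d) /
            Real.Gamma (((n : ℝ) - d) / 2) *
            ((v + w) / (2 * n * v * w)) ^ (-(n : ℝ) / 2 - ((n : ℝ) - d) / 2)) *
          (gramMass X * ((v + n * (v + w)) / (2 * n * v * (v + w))) ^ (-(d : ℝ) / 2) *
            Real.exp (-(n * (v + w) / (2 * v * (v + n * (v + w))) * R))) *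
          (gramMass (X.submatrix id e) * (1 / (2 * (v + n * (v + w)))) ^ (-(d0 : ℝ) / 2) *
            Real.exp (-(1 / (2 * (v + n * (v + w))) * R0)))) =
      ∫⁻ φ in Set.Ioo (0 : ℝ) (Real.pi / 2), ENNReal.ofReal (k φ *
        (v ^ (-(((n : ℝ) - d0) / 2) - 1) * Real.exp (-((n * R + Real.sin φ ^ 2 * R0) /
          (2 * (n + Real.sin φ ^ 2)) / v)))) := fun v hv => by
    have hv' : 0 < v := hv
    rw [lintegral_Ioi_eq_lintegral_cot_sq hv']
    refine setLIntegral_congr_fun measurableSet_Ioo fun φ hφ => ?_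
    have := hs φ hφ
    have := hcos φ hφ
    rw [← ENNReal.ofReal_mul (by positivity), varianceIntegrand_cot_sq hn' hv' (hs φ hφ)
      (hcos φ hφ) (Real.sin_sq_add_cos_sq φ)]
  -- With `v` innermost, the inverse-gamma rate is positive even if `R = 0`, because `R0` and `sin
  -- φ` are positive.
  rw [setLIntegral_congr_fun measurableSet_Ioi step1, lintegral_lintegral_swap,
    ← lintegral_const_mul' _ _ ENNReal.ofReal_ne_top,
    ← lintegral_const_mul' _ _ ENNReal.ofReal_ne_top]
  · refine setLIntegral_congr_fun measurableSet_Ioo fun φ hφ => ?_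
    have hS := hs φ hφ
    have := hcos φ hφ
    simp_rw [ENNReal.ofReal_mul (hk0 φ hφ)]
    rw [lintegral_const_mul' _ _ ENNReal.ofReal_ne_top,
      lintegral_rpow_mul_exp_neg_div (by linarith) (by positivity),
      ← ENNReal.ofReal_mul (hk0 φ hφ), ← ENNReal.ofReal_mul (by positivity),
      ← ENNReal.ofReal_mul (by positivity)]
    congr 1
    simp only [hk, baselineConst, bfIntegrand]
    exact bfIntegrand_const hn' hS hR hy hD hc hG
  · refine Measurable.aemeasurable ?_
    simp only [hk]
    fun_prop

/-- Since `d` and `d0` are integers below `n`, the exponents of sine and cosine are nonnegative; `R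
> 0` keeps the denominator away from zero. -/
theorem continuous_bfIntegrand (hd : d < n) (hd0 : d0 < n) {R R0 : ℝ} (hR : 0 < R)
    (hR0 : 0 < R0) : Continuous (bfIntegrand n d d0 R R0) := by
  have hn' : (0 : ℝ) < n := by exact_mod_cast (show 0 < n by omega)
  have h1 : (0 : ℝ) ≤ (n : ℝ) - d - 1 := by
    have : (d : ℝ) + 1 ≤ n := by exact_mod_cast hd
    linarith
  have h2 : (0 : ℝ) ≤ (n : ℝ) - d0 - 1 := by
    have : (d0 : ℝ) + 1 ≤ n := by exact_mod_cast hd0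
    linarith
  have hden : ∀ φ, 0 < (n : ℝ) * (R / R0) + Real.sin φ ^ 2 := fun φ => by positivity
  unfold bfIntegrand
  refine Continuous.div ?_ ?_ fun φ => (Real.rpow_pos_of_pos (hden φ) _).ne'
  · refine ((Real.continuous_sin.rpow_const fun _ => Or.inr h2).mul
      (Real.continuous_cos.rpow_const fun _ => Or.inr h1)).mul ?_
    exact (continuous_const.add (Real.continuous_sin.pow 2)).rpow_const fun φ =>
      Or.inr (by linarith)
  · exact (continuous_const.add (Real.continuous_sin.pow 2)).rpow_const fun φ =>
      Or.inl (hden φ).ne'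

theorem bfIntegrand_nonneg {R R0 φ : ℝ} (hR : 0 ≤ R) (hR0 : 0 ≤ R0)
    (hφ : φ ∈ Set.Ioo (0 : ℝ) (Real.pi / 2)) : 0 ≤ bfIntegrand n d d0 R R0 φ := by
  have hs : 0 < Real.sin φ :=
    Real.sin_pos_of_pos_of_lt_pi hφ.1 (by linarith [hφ.2, Real.pi_pos])
  have hcos : 0 < Real.cos φ :=
    Real.cos_pos_of_mem_Ioo ⟨by linarith [hφ.1, Real.pi_pos], hφ.2⟩
  unfold bfIntegrand
  positivity

theorem lintegral_bfIntegrand (hd : d < n) (hd0 : d0 < n) {R R0 : ℝ} (hR : 0 < R)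
    (hR0 : 0 < R0) :
    ∫⁻ φ in Set.Ioo (0 : ℝ) (Real.pi / 2), ENNReal.ofReal (bfIntegrand n d d0 R R0 φ) =
      ENNReal.ofReal (∫ φ in (0 : ℝ)..(Real.pi / 2), bfIntegrand n d d0 R R0 φ) := by
  rw [intervalIntegral.integral_of_le (by positivity), integral_Ioc_eq_integral_Ioo,
    ofReal_integral_eq_lintegral_ofReal]
  · exact ((continuous_bfIntegrand hd hd0 hR hR0).integrableOn_Icc
      (a := 0) (b := Real.pi / 2)).mono_set Set.Ioo_subset_Icc_self
  · filter_upwards [ae_restrict_mem measurableSet_Ioo] with φ hφ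
    exact bfIntegrand_nonneg hR.le hR0.le hφ

end BayesFactor

end JPEP

theorem mainTheorem2 {n d d0 : ℕ}
    (X : Matrix (Fin n) (Fin d) ℝ) (X0 : Matrix (Fin n) (Fin d0) ℝ)
    -- the reference model is nested: its design matrix consists of columns of `X`
    (e : Fin d0 ↪ Fin d) (hX0 : X0 = X.submatrix id e)
    (hrank : X.rank = d) (hd : d < n)
    (c c0 : ℝ) (hc : 0 < c) (hc0 : 0 < c0)
    (y : Fin n → ℝ) (hy : 0 < JPEP.rss X0 y) :
    -- the denominator of the Bayes factor is positive and finite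
    (JPEP.marginalLikelihood X0 (JPEP.baselinePrior c0) y ≠ 0 ∧
      JPEP.marginalLikelihood X0 (JPEP.baselinePrior c0) y ≠ ⊤) ∧
    -- the closed form, as an identity in `[0, ∞]`
    JPEP.jpepBayesFactor c c0 X X0 X X0 (n : ℝ) y =
      ENNReal.ofReal (2 * Real.Gamma ((n : ℝ) - d) / Real.Gamma (((n : ℝ) - d) / 2) ^ 2) *
        (∫⁻ φ in Set.Ioo (0 : ℝ) (Real.pi / 2),
          ENNReal.ofReal (JPEP.bfIntegrand n d d0 (JPEP.rss X y) (JPEP.rss X0 y) φ)) ∧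
    -- the closed form, as an identity of finite numbers
    (0 < JPEP.rss X y →
      IntervalIntegrable (JPEP.bfIntegrand n d d0 (JPEP.rss X y) (JPEP.rss X0 y))
        MeasureTheory.volume 0 (Real.pi / 2) ∧
      JPEP.jpepBayesFactor c c0 X X0 X X0 (n : ℝ) y ≠ ⊤ ∧
      (JPEP.jpepBayesFactor c c0 X X0 X X0 (n : ℝ) y).toReal =
        2 * Real.Gamma ((n : ℝ) - d) / Real.Gamma (((n : ℝ) - d) / 2) ^ 2 *
          ∫ φ in (0 : ℝ)..(Real.pi / 2),
            JPEP.bfIntegrand n d d0 (JPEP.rss X y) (JPEP.rss X0 y) φ) := by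
  subst hX0
  have h := JPEP.mulVec_injective_of_rank_eq hrank
  have h0 := JPEP.mulVec_submatrix_injective e h
  have hd0 : d0 < n :=
    lt_of_le_of_lt (by simpa using Fintype.card_le_of_embedding e) hd
  have hm : (0 : ℝ) < (n : ℝ) - d := by rw [sub_pos]; exact_mod_cast hd
  have hG : 0 < Real.Gamma (((n : ℝ) - d) / 2) := Real.Gamma_pos_of_pos (by linarith)
  have hG2 : 0 < Real.Gamma ((n : ℝ) - d) := Real.Gamma_pos_of_pos hm
  have hB := JPEP.baselineConst_pos h0 hd0 hc0
  have hden := JPEP.marginalLikelihood_baselinePrior h0 hd0 hc0 hy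
  have hden0 : JPEP.marginalLikelihood (X.submatrix id e) (JPEP.baselinePrior c0) y ≠ 0 := by
    rw [hden, Ne, ENNReal.ofReal_eq_zero, not_le]; positivity
  have hdent : JPEP.marginalLikelihood (X.submatrix id e) (JPEP.baselinePrior c0) y ≠ ⊤ := by
    rw [hden]; exact ENNReal.ofReal_ne_top
  have hBF : JPEP.jpepBayesFactor c c0 X (X.submatrix id e) X (X.submatrix id e) (n : ℝ) y =
      ENNReal.ofReal (2 * Real.Gamma ((n : ℝ) - d) / Real.Gamma (((n : ℝ) - d) / 2) ^ 2) *
        (∫⁻ φ in Set.Ioo (0 : ℝ) (Real.pi / 2), ENNReal.ofReal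
          (JPEP.bfIntegrand n d d0 (JPEP.rss X y) (JPEP.rss (X.submatrix id e) y) φ)) := by
    -- The first factor of the numerator is the reference marginal itself; being neither `0` nor
    -- `⊤`, it cancels.
    rw [JPEP.jpepBayesFactor, JPEP.marginalLikelihood_jpepPrior_eq e h hd hc hc0 y hy, ← hden,
      mul_comm, ENNReal.mul_div_cancel_right hden0 hdent]
  refine ⟨⟨hden0, hdent⟩, hBF, fun hR => ?_⟩
  have hint := JPEP.lintegral_bfIntegrand hd hd0 hR hy
  have hnn : 0 ≤ ∫ φ in (0 : ℝ)..(Real.pi / 2),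
      JPEP.bfIntegrand n d d0 (JPEP.rss X y) (JPEP.rss (X.submatrix id e) y) φ := by
    rw [intervalIntegral.integral_of_le (by positivity),
      MeasureTheory.integral_Ioc_eq_integral_Ioo]
    exact MeasureTheory.setIntegral_nonneg measurableSet_Ioo fun φ hφ =>
      JPEP.bfIntegrand_nonneg hR.le hy.le hφ
  rw [hBF, hint, ← ENNReal.ofReal_mul (by positivity)]
  exact ⟨(JPEP.continuous_bfIntegrand hd hd0 hR hy).intervalIntegrable _ _,
    ENNReal.ofReal_ne_top, ENNReal.toReal_ofReal (by positivity)⟩
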